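/- **Proposition 3 ($M$-particle unitary evolution).** Let $\mathcal H$ be a complex Hilbert space, $R^1,\dots,R^d$ self-adjoint operators in $\mathcal H$, $\hbar,\kappa>0$, and let the pointer scale be $\Lambda=\mathbb R^d$ with Lebesgue measure $\lambda$ or $\Lambda=\varepsilon\mathbb Z^d$ ($\varepsilon>0$) with mass $\varepsilon^d$ at each point. Let $P_\alpha$ be the components of the momentum in $L^2(\Lambda)$, that is, $P_\alpha=-i\hbar\,\partial/\partial y^\alpha$ on $\mathbb R^d$, and the operator with matrix elements $(\mathbf y|P_\alpha|\mathbf q)=(2\pi\hbar)^{-d}\int p_\alpha e^{i(\mathbf y-\mathbf q)\cdot\mathbf p/\hbar}\,d\mathbf p$, with integration over $\pi\hbar[-1/\varepsilon,1/\varepsilon)^d$, on $\varepsilon\mathbb Z^d$. Let $f_0\in L^2(\Lambda)$ with $\|f_0\|=1$ and $f_0\neq0$ almost everywhere, $d\mu_0=|f_0|^2d\lambda$, and $\mathcal E_\infty=L^2(\Lambda^\infty,\mu_0^{\infty})$ the space of infinitely many bubbles numbered by $n=1,2,\dots$; $P_\alpha(n)$ is the operator $\varphi\mapsto f_0^{-1}P_\alpha(f_0\varphi)$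 acting in the $n$-th variable. For an operator $A$ in $\mathcal H$ let $A(k)=I^{\otimes(k-1)}\otimes A\otimes I^{\otimes(M-k)}$ in $\mathcal H^{\otimes M}$. Let $H$ be a self-adjoint operator in $\mathcal H$, let $W(k,l)$, $1\le k<l\le M$, be operators in $\mathcal H^{\otimes M}$, and let $H^M$ be a self-adjoint operator in $\mathcal H^{\otimes M}$ that extends $\sum_kH(k)+\sum_{k<l}W(k,l)$ (defined on the intersection of the domains). In $\mathcal H^{\otimes M}\otimes\mathcal E_\infty$ put $H_0^M=H^M\otimes\mathbf 1$, $U_0^M(t)=\exp\{-\frac i\hbar H_0^Mt\}$, and $$S(k,n)=\exp\Bigl\{-\frac i\hbar\,\kappa\,\mathbf R(k)\otimes\mathbf P(n)\Bigr\},\qquad \mathbf R(k)\otimes\mathbf P(n)=\sum_{\alpha=1}^dR^\alpha(k)\otimes P_\alpha(n),$$ where the sum denotes the closure of its restriction to the algebraic tensor product of the common domain of the $R^\alpha(k)$ and the common domain of the $P_\alpha(n)$. (This closure is self-adjoint, for instance, if the $R^\alpha$ commute strongly; where it is not self-adjoint, $S(k,n)$ is taken to be the identity.) Let $\tau_\bullet=(\tau_1,\dots,\tau_M)$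 be pairwise disjoint subsets of $(0,\infty)$ whose union $\tau$ meets every interval $[0,t)$ in a finite set. Write $\tau=\{t_1<t_2<\cdots\}$, let $k_n$ be the index with $t_n\in\tau_{k_n}$, let $n_t=|\tau\cap[0,t)|$, and let $\psi_0^M\in\mathcal H^{\otimes M}\otimes\mathcal E_\infty$ (for example in $\mathcal H^M\otimes\mathcal E_\infty$, where $\mathcal H^M\subseteq\mathcal H^{\otimes M}$ is the subspace of symmetric or of antisymmetric tensors). Consider on $[0,\infty)$ the equation, with forward differentials and with the bubble $n$ scattered at the time $t_n$ by the particle $k_n$, $$d\psi(t)+\frac i\hbar H_0^M\psi(t)\,dt=(S(k_t,n_t)-I)\,\psi(t)\,dn_t,\qquad\psi(0)=\psi_0^M,\tag{3.2}$$ in the integrated weak sense: for all $t\ge0$ and all $\varphi$ in the domain of $H_0^M$, the function $s\mapsto\langle H_0^M\varphi,\psi(s)\rangle$ is integrable on $[0,t]$ and $$\langle\varphi,\psi(t)\rangle+\frac i\hbar\int_0^t\langle H_0^M\varphi,\psi(s)\rangle\,ds=\langle\varphi,\psi_0^M\rangle+\sum_{n:\,t_n<t}\langle\varphi,(S(k_n,n)-I)\psi(t_n)\rangle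 .$$ Then (3.2) has exactly one solution, namely $\psi(t,\tau_\bullet)=U(t,\tau_\bullet)\psi_0^M$ with the unitary operators $U(t,\tau_\bullet)=U_0^M(t)V_t^\dagger(\tau_\bullet)$, where $V_t(\tau_\bullet)$ is the finite chronological product $$V_t(\tau_\bullet)=S_t^\dagger(k_1,t_1)\,S_t^\dagger(k_2,t_2)\cdots S_t^\dagger(k_{n_t},t_{n_t}),\qquad S_t(k_n,t_n)=U_0^{M\dagger}(t_n)\,S(k_n,n)\,U_0^M(t_n)\quad(t_n<t).$$ -/

import Mathlib

open MeasureTheory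
open scoped TensorProduct InnerProductSpace

noncomputable section

namespace QScatter

/-! ## Hilbert tensor powers and Hilbert tensor products -/

section TensorPower

open scoped ComplexOrder

/-- The algebraic tensor power `𝓗 ⊗ ⋯ ⊗ 𝓗` (`M` factors), as a type of its own, so that it can carry
the Hilbert space inner product (Mathlib puts the projective seminorm on `⨂[ℂ] _ : Fin M, 𝓗`). -/
def AlgTensorPower (𝓗 : Type*) [NormedAddCommGroup 𝓗] [InnerProductSpace ℂ 𝓗] (M : ℕ) : Type _ :=
  ⨂[ℂ] _ : Fin M, 𝓗

variable {𝓗 : Type*} [NormedAddCommGroup 𝓗] [InnerProductSpace ℂ 𝓗] {M : ℕ}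

instance : AddCommGroup (AlgTensorPower 𝓗 M) :=
  inferInstanceAs (AddCommGroup (⨂[ℂ] _ : Fin M, 𝓗))

instance : Module ℂ (AlgTensorPower 𝓗 M) :=
  inferInstanceAs (Module ℂ (⨂[ℂ] _ : Fin M, 𝓗))

/-- The product vector `η₁ ⊗ ⋯ ⊗ η_M` in the algebraic tensor power. -/
def algProd : MultilinearMap ℂ (fun _ : Fin M => 𝓗) (AlgTensorPower 𝓗 M) :=
  PiTensorProduct.tprod ℂ

/-- For fixed `ξ` the linear functional `⊗ η ↦ ∏ i, ⟪ξ i, η i⟫`. -/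
def prodFunctional (ξ : Fin M → 𝓗) : AlgTensorPower 𝓗 M →ₗ[ℂ] ℂ :=
  PiTensorProduct.lift
    ((MultilinearMap.mkPiAlgebra ℂ (Fin M) ℂ).compLinearMap fun i => innerₛₗ ℂ (ξ i))

theorem prodFunctional_algProd (ξ η : Fin M → 𝓗) :
    prodFunctional ξ (algProd η) = ∏ i, ⟪ξ i, η i⟫_ℂ := by
  unfold prodFunctional algProd
  exact (PiTensorProduct.lift.tprod _).trans (by simp)

theorem alg_ext {f g : AlgTensorPower 𝓗 M →ₗ[ℂ] ℂ}
    (h : ∀ η, f (algProd η) = g (algProd η)) : f = g :=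
  PiTensorProduct.ext (R := ℂ) (s := fun _ : Fin M => 𝓗) (MultilinearMap.ext h)

theorem span_algProd :
    Submodule.span ℂ (Set.range (algProd : (Fin M → 𝓗) → AlgTensorPower 𝓗 M)) = ⊤ :=
  PiTensorProduct.span_tprod_eq_top

/-- The map `⊗ ξ ↦ (t ↦ conj (prodFunctional ξ t))`. -/
def conjFunctional :
    MultilinearMap ℂ (fun _ : Fin M => 𝓗) (AlgTensorPower 𝓗 M →ₗ⋆[ℂ] ℂ) where
  toFun ξ := (starLinearEquiv ℂ (A := ℂ)).toLinearMap.comp (prodFunctional ξ)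
  map_update_add' := by
    intro inst ξ i x y
    have : prodFunctional (Function.update ξ i (x + y)) =
        prodFunctional (Function.update ξ i x) + prodFunctional (Function.update ξ i y) := by
      apply alg_ext
      intro η
      simp only [LinearMap.add_apply, prodFunctional_algProd]
      rw [← Finset.mul_prod_erase _ _ (Finset.mem_univ i),
        ← Finset.mul_prod_erase _ _ (Finset.mem_univ i),
        ← Finset.mul_prod_erase _ _ (Finset.mem_univ i)]
      have e : ∀ z : 𝓗, ∏ j ∈ Finset.univ.erase i, ⟪Function.update ξ i z j, η j⟫_ℂ
          = ∏ j ∈ Finset.univ.erase i, ⟪ξ j, η j⟫_ℂ := fun z =>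
        Finset.prod_congr rfl fun j hj => by
          rw [Function.update_of_ne (Finset.ne_of_mem_erase hj)]
      simp only [e, Function.update_self, inner_add_left]
      ring
    ext t
    simp [this]
  map_update_smul' := by
    intro inst ξ i c x
    have : prodFunctional (Function.update ξ i (c • x)) =
        (starRingEnd ℂ c) • prodFunctional (Function.update ξ i x) := by
      apply alg_ext
      intro η
      simp only [LinearMap.smul_apply, prodFunctional_algProd]
      rw [← Finset.mul_prod_erase _ _ (Finset.mem_univ i),
        ← Finset.mul_prod_erase _ _ (Finset.mem_univ i)]
      have e : ∀ z : 𝓗, ∏ j ∈ Finset.univ.erase i, ⟪Function.update ξ i z j, η j⟫_ℂ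
          = ∏ j ∈ Finset.univ.erase i, ⟪ξ j, η j⟫_ℂ := fun z =>
        Finset.prod_congr rfl fun j hj => by
          rw [Function.update_of_ne (Finset.ne_of_mem_erase hj)]
      simp only [e, Function.update_self, inner_smul_left, smul_eq_mul]
      ring
    ext t
    simp [this]

/-- The linear extension of `conjFunctional`. -/
def algForm : AlgTensorPower 𝓗 M →ₗ[ℂ] AlgTensorPower 𝓗 M →ₗ⋆[ℂ] ℂ :=
  PiTensorProduct.lift conjFunctional

theorem algForm_algProd (η : Fin M → 𝓗) : algForm (algProd η) = conjFunctional η :=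
  PiTensorProduct.lift.tprod _

/-- The sesquilinear form with `⟪⊗ ξ, ⊗ η⟫ = ∏ i, ⟪ξ i, η i⟫`. -/
instance : Inner ℂ (AlgTensorPower 𝓗 M) where
  inner s t := algForm t s

theorem alg_inner_add_left (s s' t : AlgTensorPower 𝓗 M) :
    ⟪s + s', t⟫_ℂ = ⟪s, t⟫_ℂ + ⟪s', t⟫_ℂ :=
  LinearMap.map_add _ _ _

theorem alg_inner_smul_left (s t : AlgTensorPower 𝓗 M) (c : ℂ) :
    ⟪c • s, t⟫_ℂ = starRingEnd ℂ c * ⟪s, t⟫_ℂ :=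
  LinearMap.map_smulₛₗ _ _ _

theorem alg_inner_add_right (s t t' : AlgTensorPower 𝓗 M) :
    ⟪s, t + t'⟫_ℂ = ⟪s, t⟫_ℂ + ⟪s, t'⟫_ℂ := by
  change algForm (t + t') s = _
  rw [map_add]; rfl

theorem alg_inner_smul_right (s t : AlgTensorPower 𝓗 M) (c : ℂ) :
    ⟪s, c • t⟫_ℂ = c * ⟪s, t⟫_ℂ := by
  change algForm (c • t) s = _
  rw [map_smul]; rfl

theorem alg_inner_algProd (ξ η : Fin M → 𝓗) :
    ⟪(algProd ξ : AlgTensorPower 𝓗 M), algProd η⟫_ℂ = ∏ i, ⟪ξ i, η i⟫_ℂ := by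
  change algForm (algProd η) (algProd ξ) = _
  rw [algForm_algProd]
  change star (prodFunctional η (algProd ξ)) = _
  rw [prodFunctional_algProd, star_prod]
  exact Finset.prod_congr rfl fun i _ => inner_conj_symm _ _

theorem alg_exists_finsupp (t : AlgTensorPower 𝓗 M) :
    ∃ c : (Fin M → 𝓗) →₀ ℂ, t = c.sum fun η a => a • algProd η := by
  have h : t ∈ Submodule.span ℂ (Set.range (algProd : (Fin M → 𝓗) → AlgTensorPower 𝓗 M)) := by
    rw [span_algProd]; trivial
  obtain ⟨c, hc⟩ := (Finsupp.mem_span_range_iff_exists_finsupp).1 h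
  exact ⟨c, hc.symm⟩

/-- The form as an additive map in each variable. -/
def algInnerHom : AlgTensorPower 𝓗 M →+ AlgTensorPower 𝓗 M →+ ℂ :=
  AddMonoidHom.mk' (fun s => AddMonoidHom.mk' (fun t => ⟪s, t⟫_ℂ) (alg_inner_add_right s))
    (fun s s' => by ext t; exact alg_inner_add_left s s' t)

theorem alg_inner_sum (c e : (Fin M → 𝓗) →₀ ℂ) :
    ⟪(c.sum fun η a => a • algProd η : AlgTensorPower 𝓗 M), e.sum fun η a => a • algProd η⟫_ℂ
      = c.sum fun ξ a => e.sum fun η b => star a * (∏ i, ⟪ξ i, η i⟫_ℂ) * b := by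
  change algInnerHom _ _ = _
  simp only [Finsupp.sum, map_sum, AddMonoidHom.finsetSum_apply]
  rw [Finset.sum_comm]
  refine Finset.sum_congr rfl fun ξ _ => Finset.sum_congr rfl fun η _ => ?_
  change ⟪c ξ • algProd ξ, e η • algProd η⟫_ℂ = _
  rw [alg_inner_smul_left, alg_inner_smul_right, alg_inner_algProd]
  change star (c ξ) * _ = _
  ring

theorem posSemidef_prodKernel {ι : Type*} [Finite ι] (x : ι → Fin M → 𝓗) :
    (Matrix.of fun j l : ι => ∏ i, ⟪x j i, x l i⟫_ℂ).PosSemidef := by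
  classical
  have key : ∀ s : Finset (Fin M),
      (Matrix.of fun j l : ι => ∏ i ∈ s, ⟪x j i, x l i⟫_ℂ).PosSemidef := by
    intro s
    induction s using Finset.induction_on with
    | empty =>
      have h := Matrix.posSemidef_gram (𝕜 := ℂ) (E := ℂ) (n := ι) (fun _ => (1 : ℂ))
      have e : (Matrix.of fun j l : ι => ∏ i ∈ (∅ : Finset (Fin M)), ⟪x j i, x l i⟫_ℂ) =
          Matrix.gram ℂ (fun _ : ι => (1 : ℂ)) := by
        ext j l
        simp [Matrix.gram]
      rw [e]
      exact h
    | insert a s ha ih =>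
      have h := (Matrix.posSemidef_gram (𝕜 := ℂ) (fun j : ι => x j a)).hadamard ih
      have e : (Matrix.of fun j l : ι => ∏ i ∈ insert a s, ⟪x j i, x l i⟫_ℂ) =
          Matrix.hadamard (Matrix.gram ℂ (fun j : ι => x j a))
            (Matrix.of fun j l : ι => ∏ i ∈ s, ⟪x j i, x l i⟫_ℂ) := by
        ext j l
        simp [Finset.prod_insert ha, Matrix.gram, Matrix.hadamard]
      rw [e]
      exact h
  exact key Finset.univ

instance algCore : PreInnerProductSpace.Core ℂ (AlgTensorPower 𝓗 M) where
  conj_inner_symm s t := by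
    obtain ⟨c, rfl⟩ := alg_exists_finsupp s
    obtain ⟨e, rfl⟩ := alg_exists_finsupp t
    rw [alg_inner_sum, alg_inner_sum]
    simp only [Finsupp.sum, map_sum, map_mul, map_prod, inner_conj_symm]
    rw [Finset.sum_comm]
    refine Finset.sum_congr rfl fun ξ _ => Finset.sum_congr rfl fun η _ => ?_
    simp only [starRingEnd_apply, star_star]
    ring
  re_inner_nonneg t := by
    obtain ⟨c, rfl⟩ := alg_exists_finsupp t
    rw [alg_inner_sum]
    have h := (posSemidef_prodKernel (fun j : c.support => (j : Fin M → 𝓗))).dotProduct_mulVec_nonneg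
      (fun j => c j)
    have e : (c.sum fun ξ a => c.sum fun η b => star a * (∏ i, ⟪ξ i, η i⟫_ℂ) * b) =
        star (fun j : c.support => c j) ⬝ᵥ
          (Matrix.of fun j l : c.support =>
            ∏ i, ⟪(j : Fin M → 𝓗) i, (l : Fin M → 𝓗) i⟫_ℂ).mulVec (fun j => c j) := by
      simp only [Finsupp.sum, dotProduct, Matrix.mulVec, Matrix.of_apply, Pi.star_apply,
        Finset.mul_sum]
      rw [← Finset.sum_coe_sort c.support]
      refine Finset.sum_congr rfl fun j _ => ?_
      rw [← Finset.sum_coe_sort c.support]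
      exact Finset.sum_congr rfl fun l _ => by ring
    rw [e]
    exact (Complex.le_def.1 h).1
  add_left := alg_inner_add_left
  smul_left s t c := alg_inner_smul_left s t c

instance : SeminormedAddCommGroup (AlgTensorPower 𝓗 M) :=
  InnerProductSpace.Core.toSeminormedAddCommGroup (𝕜 := ℂ)

instance : InnerProductSpace ℂ (AlgTensorPower 𝓗 M) := InnerProductSpace.ofCore algCore

/-- The Hilbert space tensor power `𝓗^{⊗M}`. -/
abbrev TensorPower (𝓗 : Type*) [NormedAddCommGroup 𝓗] [InnerProductSpace ℂ 𝓗] (M : ℕ) : Type _ :=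
  UniformSpace.Completion (AlgTensorPower 𝓗 M)

/-- The product vector `η₁ ⊗ ⋯ ⊗ η_M` in `𝓗^{⊗M}`. -/
def prodVec (η : Fin M → 𝓗) : TensorPower 𝓗 M := ((algProd η : AlgTensorPower 𝓗 M) : _)

theorem inner_prodVec (ξ η : Fin M → 𝓗) :
    ⟪(prodVec ξ : TensorPower 𝓗 M), prodVec η⟫_ℂ = ∏ i, ⟪ξ i, η i⟫_ℂ := by
  unfold prodVec
  rw [UniformSpace.Completion.inner_coe]
  exact alg_inner_algProd ξ η

end TensorPower

/-- The Hilbert space tensor product `X ⊗ Y`. -/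
abbrev HilbertTensor (X Y : Type*) [NormedAddCommGroup X] [InnerProductSpace ℂ X]
    [NormedAddCommGroup Y] [InnerProductSpace ℂ Y] : Type _ :=
  UniformSpace.Completion (X ⊗[ℂ] Y)

/-- The product vector `x ⊗ y` in the Hilbert space tensor product. -/
def htmul {X Y : Type*} [NormedAddCommGroup X] [InnerProductSpace ℂ X]
    [NormedAddCommGroup Y] [InnerProductSpace ℂ Y] (x : X) (y : Y) : HilbertTensor X Y :=
  ((x ⊗ₜ[ℂ] y : X ⊗[ℂ] Y) : _)

/-! ## Unbounded operators and their exponentials -/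

section Operators

variable {K : Type*} [NormedAddCommGroup K] [InnerProductSpace ℂ K]

/-- The closed operator whose graph is the closed linear span of a set `G` of pairs `(x, A x)`. -/
def opOfPairs (G : Set (K × K)) : K →ₗ.[ℂ] K :=
  (Submodule.span ℂ G).topologicalClosure.toLinearPMap

variable [CompleteSpace K]

/-- `U` is the strongly continuous one-parameter unitary group with generator `-i A`, domains
included: `A` is exactly the set of `(x, y)` with `d/dt U(t) x = -i y` at `t = 0`. -/
structure IsExpGroup (A : K →ₗ.[ℂ] K) (U : ℝ → K →L[ℂ] K) : Prop where
  zero : U 0 = 1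
  add : ∀ s t, U (s + t) = U s * U t
  unitary : ∀ t, U t ∈ unitary (K →L[ℂ] K)
  continuous : ∀ x, Continuous fun t => U t x
  generator : ∀ x y, (x, y) ∈ A.graph ↔ HasDerivAt (fun t => U t x) (-Complex.I • y) 0

open Classical in
/-- The unitary operator `exp(-i s A)` of a self-adjoint operator `A`, that is, the value at `s` of
the unique unitary group with generator `-i A`.  (The value `1` is used where there is no such group,
which is to say when `A` is not self-adjoint.) -/
def expNegI (A : K →ₗ.[ℂ] K) (s : ℝ) : K →L[ℂ] K :=
  if h : ∃ U : ℝ → K →L[ℂ] K, IsExpGroup A U then h.choose s else 1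

end Operators

/-! ## The meter -/

/-- The pointer scale `Λ`: all of `ℝᵈ`, or the lattice `εℤᵈ`. -/
inductive PointerScale where
  | continuous : PointerScale
  | lattice (ε : ℝ) (hε : 0 < ε) : PointerScale

/-- The measure `dλ` of the pointer scale, as a measure on `ℝᵈ`: Lebesgue measure on `ℝᵈ`, or
mass `ε^d` at each point of the lattice `εℤᵈ` (and no mass elsewhere). -/
def PointerScale.measure (d : ℕ) : PointerScale → Measure (Fin d → ℝ)
  | .continuous => volume
  | .lattice ε _ => Measure.sum fun z : Fin d → ℤ =>
      ENNReal.ofReal (ε ^ d) • Measure.dirac fun α => ε * (z α : ℝ)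

/-- The range of the momentum variable: `ℝᵈ`, or `πħ[-1/ε, 1/ε)ᵈ` for the lattice `εℤᵈ`. -/
def PointerScale.momentumRange (d : ℕ) (ħ : ℝ) : PointerScale → Set (Fin d → ℝ)
  | .continuous => Set.univ
  | .lattice ε _ => {p | ∀ α, p α ∈ Set.Ico (-(Real.pi * ħ / ε)) (Real.pi * ħ / ε)}

section Meter

variable {d : ℕ} {D : PointerScale}

/-- The wave function `y ↦ (2πħ)^{-d} ∫ φ(p) e^{i y·p/ħ} dp` with momentum amplitude `φ`. -/
def ofMomentum (ħ : ℝ) (φ : (Fin d → ℝ) → ℂ) (y : Fin d → ℝ) : ℂ :=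
  (((2 * Real.pi * ħ) ^ d : ℝ) : ℂ)⁻¹ *
    ∫ p, φ p * Complex.exp (Complex.I * ((∑ β, y β * p β) / ħ : ℝ))

/-- The momentum component `P_α` on `L²(Λ)`: multiplication by `p_α` in the momentum representation,
as the closure of its restriction to the wave functions with bounded and boundedly supported momentum
amplitudes.  It is `-iħ ∂/∂y^α` on `ℝᵈ`, and on the lattice it has the matrix elements
`(y|P_α|q) = (2πħ)^{-d} ∫ p_α e^{i(y-q)·p/ħ} dp`. -/
def momentum (D : PointerScale) (d : ℕ) (ħ : ℝ) (α : Fin d) :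
    Lp ℂ 2 (D.measure d) →ₗ.[ℂ] Lp ℂ 2 (D.measure d) :=
  opOfPairs {z | ∃ φ : (Fin d → ℝ) → ℂ, Measurable φ ∧
    (∃ C : ℝ, ∀ p, ‖φ p‖ ≤ C ∧ (φ p ≠ 0 → ‖p‖ ≤ C ∧ p ∈ D.momentumRange d ħ)) ∧
    z.1 =ᵐ[D.measure d] ofMomentum ħ φ ∧
    z.2 =ᵐ[D.measure d] ofMomentum ħ fun p => (p α : ℂ) * φ p}

/-- The probability distribution `dμ₀ = |f₀|² dλ` of the pointer in the state `f₀`. -/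
def meterMeasure (f₀ : Lp ℂ 2 (D.measure d)) : Measure (Fin d → ℝ) :=
  (D.measure d).withDensity fun y => ‖f₀ y‖ₑ ^ 2

/-- The space `𝓔 = L²(Λ, μ₀)`, which is `L²(Λ)` after division by `f₀`. -/
abbrev MeterSpace (f₀ : Lp ℂ 2 (D.measure d)) : Type := Lp ℂ 2 (meterMeasure f₀)

/-- The momentum component `P_α` carried over to `𝓔`: `φ ↦ f₀⁻¹ P_α (f₀ φ)`. -/
def meterMomentum (ħ : ℝ) (f₀ : Lp ℂ 2 (D.measure d)) (α : Fin d) :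
    MeterSpace f₀ →ₗ.[ℂ] MeterSpace f₀ :=
  opOfPairs {z | ∃ w ∈ (momentum D d ħ α).graph,
    (∀ᵐ y ∂(D.measure d), w.1 y = f₀ y * z.1 y) ∧ ∀ᵐ y ∂(D.measure d), w.2 y = f₀ y * z.2 y}

/-- The space `𝓔_∞ = L²(Λ^∞, μ₀^∞)` of the infinitely many bubbles.  The bubbles are numbered by
`0, 1, 2, …`. -/
abbrev BubbleSpace (f₀ : Lp ℂ 2 (D.measure d)) : Type :=
  Lp ℂ 2 (Measure.infinitePi fun _ : ℕ => meterMeasure f₀)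

/-- The operator of `𝓔_∞` that acts as `B` on the bubble number `n` and trivially on the others:
on products `∏ j, φ_j(y_j)` with almost all `φ_j = 1` it replaces `φ_n` by `B φ_n`. -/
def bubbleOp {f₀ : Lp ℂ 2 (D.measure d)} (B : MeterSpace f₀ →ₗ.[ℂ] MeterSpace f₀) (n : ℕ) :
    BubbleSpace f₀ →ₗ.[ℂ] BubbleSpace f₀ :=
  opOfPairs {z | ∃ (φ : ℕ → MeterSpace f₀) (χ : MeterSpace f₀) (s : Finset ℕ), n ∈ s ∧
    (φ n, χ) ∈ B.graph ∧
    (z.1 =ᵐ[Measure.infinitePi fun _ : ℕ => meterMeasure f₀] fun y => ∏ j ∈ s, φ j (y j)) ∧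
    z.2 =ᵐ[Measure.infinitePi fun _ : ℕ => meterMeasure f₀]
      fun y => ∏ j ∈ s, (Function.update φ n χ) j (y j)}

end Meter

/-! ## The particles, the total Hamiltonian and the scattering operators -/

section Particles

variable {𝓗 : Type*} [NormedAddCommGroup 𝓗] [InnerProductSpace ℂ 𝓗] {M : ℕ}

/-- `A(k) = I^{⊗(k-1)} ⊗ A ⊗ I^{⊗(M-k)}`. -/
def slotOp (A : 𝓗 →ₗ.[ℂ] 𝓗) (k : Fin M) : TensorPower 𝓗 M →ₗ.[ℂ] TensorPower 𝓗 M :=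
  opOfPairs {z | ∃ (η : Fin M → 𝓗) (y : 𝓗), (η k, y) ∈ A.graph ∧
    z = (prodVec η, prodVec (Function.update η k y))}

/-- The sum `∑ k, H(k) + ∑ k, ∑ l > k, W(k,l)` on the intersection of the domains. -/
def formalHamiltonian (H : 𝓗 →ₗ.[ℂ] 𝓗)
    (W : Fin M → Fin M → TensorPower 𝓗 M →ₗ.[ℂ] TensorPower 𝓗 M) :
    TensorPower 𝓗 M →ₗ.[ℂ] TensorPower 𝓗 M :=
  ∑ k, slotOp H k + ∑ k, ∑ l ∈ Finset.Ioi k, W k l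

/-- `A ⊗ 1` for a closed operator `A` on the first factor. -/
def tensorOne {X : Type*} [NormedAddCommGroup X] [InnerProductSpace ℂ X] (A : X →ₗ.[ℂ] X)
    (Y : Type*) [NormedAddCommGroup Y] [InnerProductSpace ℂ Y] :
    HilbertTensor X Y →ₗ.[ℂ] HilbertTensor X Y :=
  opOfPairs {z | ∃ (x x' : X) (y : Y), (x, x') ∈ A.graph ∧ z = (htmul x y, htmul x' y)}

variable {d : ℕ} {D : PointerScale}

/-- `𝐑(k) ⊗ 𝐏(n) = ∑ α, R^α(k) ⊗ P_α(n)`, as the closure of this sum on the algebraic tensor product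
of the common domain of the `R^α(k)` and the common domain of the `P_α(n)`. -/
def scatteringExponent (ħ : ℝ) (R : Fin d → 𝓗 →ₗ.[ℂ] 𝓗) (f₀ : Lp ℂ 2 (D.measure d))
    (k : Fin M) (n : ℕ) :
    HilbertTensor (TensorPower 𝓗 M) (BubbleSpace f₀) →ₗ.[ℂ]
      HilbertTensor (TensorPower 𝓗 M) (BubbleSpace f₀) :=
  opOfPairs {z | ∃ (ξ : TensorPower 𝓗 M) (φ : BubbleSpace f₀)
    (a : Fin d → TensorPower 𝓗 M) (b : Fin d → BubbleSpace f₀),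
    (∀ α, (ξ, a α) ∈ (slotOp (R α) k).graph) ∧
    (∀ α, (φ, b α) ∈ (bubbleOp (meterMomentum ħ f₀ α) n).graph) ∧
    z = (htmul ξ φ, ∑ α, htmul (a α) (b α))}

/-- The scattering operator `S(k,n) = exp(-(i/ħ) κ 𝐑(k) ⊗ 𝐏(n))` of the particle `k` and the
bubble `n`. -/
def scattering (ħ κ : ℝ) (R : Fin d → 𝓗 →ₗ.[ℂ] 𝓗) (f₀ : Lp ℂ 2 (D.measure d))
    (k : Fin M) (n : ℕ) :
    HilbertTensor (TensorPower 𝓗 M) (BubbleSpace f₀) →L[ℂ]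
      HilbertTensor (TensorPower 𝓗 M) (BubbleSpace f₀) :=
  expNegI (scatteringExponent ħ R f₀ k n) (κ / ħ)

end Particles

/-! ## Scattering times -/

/-- The `M`-tuples `τ_• = (τ_1, …, τ_M)` of pairwise disjoint sets of strictly positive times whose
union is locally finite: `τ_k` is the set of the scattering times of the particle `k`. -/
structure ScatteringTimes (M : ℕ) where
  τ : Fin M → Set ℝ
  pos : ∀ k, ∀ r ∈ τ k, 0 < r
  disjoint : ∀ k l, k ≠ l → Disjoint (τ k) (τ l)
  locallyFinite : ∀ t, ((⋃ k, τ k) ∩ Set.Ico 0 t).Finite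

namespace ScatteringTimes

variable {M : ℕ} (τ : ScatteringTimes M)

/-- The finite set `τ_t = τ ∩ [0, t)` with `τ = ⋃ k, τ_k`. -/
def before (t : ℝ) : Finset ℝ := (τ.locallyFinite t).toFinset

/-- The number `n_t = |τ ∩ [0, t)|` of scatterings before `t`.  As the bubbles are numbered
from `0`, this is also the number of the bubble scattered at `t` if `t ∈ τ`. -/
def count (t : ℝ) : ℕ := (τ.before t).card

variable {K : Type*} [NormedAddCommGroup K] [InnerProductSpace ℂ K]

open Classical in
/-- The operator `S(k_t, n_t)` for `t ∈ τ`, where `k_t` is the one `k` with `t ∈ τ_k`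
(and the identity if `t ∉ τ`). -/
def scatteringAt (S : Fin M → ℕ → K →L[ℂ] K) (t : ℝ) : K →L[ℂ] K :=
  if h : ∃ k, t ∈ τ.τ k then S h.choose (τ.count t) else 1

variable [CompleteSpace K]

/-- The operator `S_t(k_n, t_n) = U₀†(t_n) S(k_n, n) U₀(t_n)` at the scattering time `r = t_n`. -/
def interactionScattering (U₀ : ℝ → K →L[ℂ] K) (S : Fin M → ℕ → K →L[ℂ] K) (r : ℝ) : K →L[ℂ] K :=
  star (U₀ r) * τ.scatteringAt S r * U₀ r

/-- The chronological product `V_t(τ_•) = S_t†(k_1,t_1) S_t†(k_2,t_2) ⋯` over the scattering times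
`t_1 < t_2 < ⋯` before `t`. -/
def chronologicalProduct (U₀ : ℝ → K →L[ℂ] K) (S : Fin M → ℕ → K →L[ℂ] K) (t : ℝ) : K →L[ℂ] K :=
  (((τ.before t).sort (· ≤ ·)).map fun r => star (τ.interactionScattering U₀ S r)).prod

/-- `U(t, τ_•) = U₀(t) V_t†(τ_•)`. -/
def evolution (U₀ : ℝ → K →L[ℂ] K) (S : Fin M → ℕ → K →L[ℂ] K) (t : ℝ) : K →L[ℂ] K :=
  U₀ t * star (τ.chronologicalProduct U₀ S t)

/-- `ψ` is a solution on `[0, ∞)`, with initial value `ψ₀`, of the equation with forward differentials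
`dψ(t) + (i/ħ) H₀ ψ(t) dt = (S(k_t, n_t) - I) ψ(t) dn_t`.

Since `H₀` may be unbounded and `ψ₀` need not be in its domain, the equation is integrated from `0` to
`t` and tested against the vectors of the domain of `H₀`.  The integral with respect to the counting
process `n_t = |τ ∩ [0, t)|` is the sum over the scattering times before `t`. -/
def IsSolution (ħ : ℝ) (H₀ : K →ₗ.[ℂ] K) (S : Fin M → ℕ → K →L[ℂ] K) (ψ₀ : K) (ψ : ℝ → K) : Prop :=
  ∀ φ : H₀.domain, ∀ t : ℝ, 0 ≤ t →
    IntervalIntegrable (fun s => ⟪H₀ φ, ψ s⟫_ℂ) volume 0 t ∧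
    ⟪(φ : K), ψ t⟫_ℂ + (Complex.I / ħ) * ∫ s in (0 : ℝ)..t, ⟪H₀ φ, ψ s⟫_ℂ =
      ⟪(φ : K), ψ₀⟫_ℂ + ∑ r ∈ τ.before t, ⟪(φ : K), (τ.scatteringAt S r - 1) (ψ r)⟫_ℂ

end ScatteringTimes

end QScatter

end

noncomputable section

namespace QScatter

open Filter Topology Complex

section Resolvent

variable {K : Type*} [NormedAddCommGroup K] [InnerProductSpace ℂ K]

/-- A symmetric operator `A` for which all the operators `A + i l`, `l ≠ 0` real, are onto. -/
structure IsMaximallySymmetric (A : K →ₗ.[ℂ] K) : Prop where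
  symm : ∀ x y x' y', (x, y) ∈ A.graph → (x', y') ∈ A.graph → ⟪y, x'⟫_ℂ = ⟪x, y'⟫_ℂ
  surj : ∀ l : ℝ, l ≠ 0 → ∀ z, ∃ x y, (x, y) ∈ A.graph ∧ y + (I * l) • x = z

theorem inner_im_eq_zero {x y : K} (h : ⟪y, x⟫_ℂ = ⟪x, y⟫_ℂ) : (⟪x, y⟫_ℂ).im = 0 := by
  have := inner_conj_symm (𝕜 := ℂ) x y
  rw [h] at this
  exact Complex.conj_eq_iff_im.1 this

theorem norm_sq_add_I_smul {x y : K} (h : ⟪y, x⟫_ℂ = ⟪x, y⟫_ℂ) (l : ℝ) :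
    ‖y + (I * l) • x‖ ^ 2 = ‖y‖ ^ 2 + ‖(I * l) • x‖ ^ 2 := by
  have h' := inner_im_eq_zero h
  rw [norm_add_sq (𝕜 := ℂ), inner_smul_right, h]
  simp [h']

/-- `J` is the scaled resolvent `i l (A + i l)⁻¹`. -/
structure IsScaledResolvent (A : K →ₗ.[ℂ] K) (l : ℝ) (J : K →L[ℂ] K) : Prop where
  norm_le : ∀ z, ‖J z‖ ≤ ‖z‖
  apply_add : ∀ x y, (x, y) ∈ A.graph → J (y + (I * l) • x) = (I * l) • x

namespace IsMaximallySymmetric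

variable {A : K →ₗ.[ℂ] K} (hA : IsMaximallySymmetric A)
include hA

theorem dense_domain [CompleteSpace K] : Dense (A.domain : Set K) := by
  rw [Submodule.dense_iff_topologicalClosure_eq_top, Submodule.topologicalClosure_eq_top_iff,
    Submodule.eq_bot_iff]
  intro z hz
  obtain ⟨x, y, hxy, rfl⟩ := hA.surj 1 one_ne_zero z
  have hx : ⟪x, y + (I * (1 : ℝ)) • x⟫_ℂ = 0 :=
    (Submodule.mem_orthogonal _ _).1 hz x (LinearPMap.mem_domain_of_mem_graph hxy)
  have him := inner_im_eq_zero (hA.symm x y x y hxy hxy)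
  have hx0 : x = 0 := by
    rw [inner_add_right, inner_smul_right] at hx
    have h1 := congrArg Complex.im hx
    simp only [add_im, him, ofReal_one, mul_one, zero_add, zero_im, I_mul_im] at h1
    have h2 : (⟪x, x⟫_ℂ).re = ‖x‖ ^ 2 := inner_self_eq_norm_sq (𝕜 := ℂ) x
    rw [h2] at h1
    simpa using h1
  have hy0 : y = 0 := A.graph_fst_eq_zero_snd hxy hx0
  simp [hx0, hy0]

theorem exists_isScaledResolvent {l : ℝ} (hl : l ≠ 0) :
    ∃ J : K →L[ℂ] K, IsScaledResolvent A l J := by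
  choose X Y hXY hz using hA.surj l hl
  have hIl : (I * l : ℂ) ≠ 0 := by simp [hl]
  have bound : ∀ x y, (x, y) ∈ A.graph → ‖(I * l) • x‖ ≤ ‖y + (I * l) • x‖ := by
    intro x y h
    have := norm_sq_add_I_smul (hA.symm x y x y h h) l
    exact le_of_sq_le_sq (by nlinarith [sq_nonneg ‖y‖]) (norm_nonneg _)
  have uniq : ∀ x y, (x, y) ∈ A.graph → X (y + (I * l) • x) = x := by
    intro x y h
    have h1 := A.graph.sub_mem (hXY (y + (I * l) • x)) h
    have h2 := bound _ _ h1
    have h3 := hz (y + (I * l) • x)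
    have h4 : Y (y + (I * l) • x) - y + (I * l) • (X (y + (I * l) • x) - x) = 0 := by
      rw [smul_sub]
      calc _ = (Y (y + (I * l) • x) + (I * l) • X (y + (I * l) • x)) - (y + (I * l) • x) := by abel
        _ = 0 := by rw [h3, sub_self]
    have h5 : (I * l : ℂ) • (X (y + (I * l) • x) - x) = 0 :=
      norm_le_zero_iff.1 (h2.trans (norm_le_zero_iff.2 h4))
    exact sub_eq_zero.1 ((smul_eq_zero.1 h5).resolve_left hIl)
  let L : K →ₗ[ℂ] K :=
    { toFun := fun z => (I * l) • X z
      map_add' := by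
        intro z w
        have h := uniq _ _ (A.graph.add_mem (hXY z) (hXY w))
        have e : Y z + Y w + (I * l : ℂ) • (X z + X w) = z + w := by
          conv_rhs => rw [← hz z, ← hz w]
          rw [smul_add]; abel
        simp only [e] at h
        rw [h, smul_add]
      map_smul' := by
        intro c z
        have h := uniq _ _ (A.graph.smul_mem c (hXY z))
        have e : c • Y z + (I * l : ℂ) • c • X z = c • z := by
          conv_rhs => rw [← hz z]
          rw [smul_add, smul_comm]
        simp only [e] at h
        rw [h, smul_comm, RingHom.id_apply] }
  refine ⟨L.mkContinuous 1 fun z => ?_, fun z => ?_, fun x y h => ?_⟩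
  · have := bound _ _ (hXY z)
    rw [hz] at this
    rwa [one_mul]
  · have := bound _ _ (hXY z)
    rwa [hz] at this
  · change (I * l : ℂ) • X _ = _
    rw [uniq x y h]

end IsMaximallySymmetric

namespace IsScaledResolvent

variable {A : K →ₗ.[ℂ] K} {l m : ℝ} {J J' : K →L[ℂ] K}

theorem apply_of_mem (hJ : IsScaledResolvent A l J) {x y : K} (h : (x, y) ∈ A.graph) :
    J y = (I * l) • (x - J x) := by
  have := hJ.apply_add x y h
  rw [map_add, map_smul] at this
  rw [smul_sub, ← this]; abel

theorem mem_graph (hA : IsMaximallySymmetric A) (hl : l ≠ 0) (hJ : IsScaledResolvent A l J)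
    (z : K) : (J z, (I * l) • (z - J z)) ∈ A.graph := by
  obtain ⟨x, y, h, rfl⟩ := hA.surj l hl z
  rw [hJ.apply_add x y h, add_sub_cancel_right]
  exact A.graph.smul_mem _ h

theorem map_mem (hA : IsMaximallySymmetric A) (hl : l ≠ 0) (hJ : IsScaledResolvent A l J)
    {x y : K} (h : (x, y) ∈ A.graph) : (J x, J y) ∈ A.graph := by
  rw [hJ.apply_of_mem h]
  exact hJ.mem_graph hA hl x

theorem commute (hA : IsMaximallySymmetric A) (hl : l ≠ 0) (hm : m ≠ 0)
    (hJ : IsScaledResolvent A l J) (hJ' : IsScaledResolvent A m J') : Commute J J' := by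
  ext z
  obtain ⟨x, y, h, rfl⟩ := hA.surj l hl z
  change J (J' _) = J' (J _)
  rw [hJ.apply_add x y h, map_add, map_smul, hJ.apply_add _ _ (hJ'.map_mem hA hm h),
    ← map_smul]

theorem inner_apply_left (hA : IsMaximallySymmetric A) (hl : l ≠ 0)
    (hJ : IsScaledResolvent A l J) (hJ' : IsScaledResolvent A (-l) J') (z w : K) :
    ⟪J z, w⟫_ℂ = ⟪z, J' w⟫_ℂ := by
  obtain ⟨x, y, h, rfl⟩ := hA.surj l hl z
  obtain ⟨x', y', h', rfl⟩ := hA.surj (-l) (neg_ne_zero.2 hl) w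
  rw [hJ.apply_add x y h, hJ'.apply_add x' y' h']
  simp only [inner_add_left, inner_add_right, inner_smul_left, inner_smul_right,
    hA.symm x y x' y' h h', map_mul, conj_I, conj_ofReal, ofReal_neg]
  ring

theorem star_eq [CompleteSpace K] (hA : IsMaximallySymmetric A) (hl : l ≠ 0)
    (hJ : IsScaledResolvent A l J) (hJ' : IsScaledResolvent A (-l) J') : star J = J' := by
  rw [ContinuousLinearMap.star_eq_adjoint]
  symm
  rw [ContinuousLinearMap.eq_adjoint_iff]
  intro z w
  have hJ2 : IsScaledResolvent A (- -l) J := by rwa [neg_neg]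
  exact hJ'.inner_apply_left hA (neg_ne_zero.2 hl) hJ2 z w

theorem norm_sub_le (hJ : IsScaledResolvent A l J) (hl : l ≠ 0) {x y : K}
    (h : (x, y) ∈ A.graph) : ‖x - J x‖ ≤ ‖y‖ / |l| := by
  have h1 := hJ.norm_le y
  rw [hJ.apply_of_mem h, norm_smul] at h1
  rw [le_div_iff₀ (abs_pos.2 hl), mul_comm]
  simpa using h1

end IsScaledResolvent

/-- Contractions that converge strongly to the identity on a dense set do so everywhere. -/
theorem tendsto_of_dense_of_contraction {T : ℕ → K →L[ℂ] K} {s : Set K}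
    (hT : ∀ n z, ‖T n z‖ ≤ ‖z‖) (hs : Dense s)
    (h : ∀ x ∈ s, Tendsto (fun n => T n x) atTop (𝓝 x)) (x : K) :
    Tendsto (fun n => T n x) atTop (𝓝 x) := by
  rw [Metric.tendsto_atTop]
  intro ε hε
  obtain ⟨y, hy, hxy⟩ := hs.exists_dist_lt x (show 0 < ε / 3 by positivity)
  obtain ⟨N, hN⟩ := Metric.tendsto_atTop.1 (h y hy) (ε / 3) (by positivity)
  refine ⟨N, fun n hn => ?_⟩
  have h1 : dist (T n x) (T n y) ≤ dist x y := by
    rw [dist_eq_norm, dist_eq_norm, ← map_sub]; exact hT n _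
  have h2 := hN n hn
  have h3 := dist_triangle4 (T n x) (T n y) y x
  rw [dist_comm y x] at h3
  linarith

/-- The Yosida approximations of `A`. -/
theorem IsMaximallySymmetric.exists_approx [CompleteSpace K] {A : K →ₗ.[ℂ] K}
    (hA : IsMaximallySymmetric A) :
    ∃ a : ℕ → K →L[ℂ] K, (∀ n, IsSelfAdjoint (a n)) ∧ (∀ m n, Commute (a m) (a n)) ∧
      (∀ n x y, (x, y) ∈ A.graph → ‖a n x‖ ≤ ‖y‖) ∧
      ∀ x y, (x, y) ∈ A.graph → Tendsto (fun n => a n x) atTop (𝓝 y) := by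
  have hn : ∀ n : ℕ, ((n : ℝ) + 1) ≠ 0 := fun n => by positivity
  have hn' : ∀ n : ℕ, -((n : ℝ) + 1) ≠ 0 := fun n => neg_ne_zero.2 (hn n)
  choose J hJ using fun n : ℕ => hA.exists_isScaledResolvent (hn n)
  choose J' hJ' using fun n : ℕ => hA.exists_isScaledResolvent (hn' n)
  have lim : ∀ (l : ℕ → ℝ) (T : ℕ → K →L[ℂ] K), (∀ n, l n ≠ 0) → (∀ n, |l n| = n + 1) →
      (∀ n, IsScaledResolvent A (l n) (T n)) → ∀ x, Tendsto (fun n => T n x) atTop (𝓝 x) := by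
    intro l T hl0 hl hT
    refine tendsto_of_dense_of_contraction (fun n => (hT n).norm_le) hA.dense_domain ?_
    intro x hx
    rw [tendsto_iff_norm_sub_tendsto_zero]
    have hmem : (x, A ⟨x, hx⟩) ∈ A.graph := A.mem_graph ⟨x, hx⟩
    refine squeeze_zero (fun _ => norm_nonneg _) (fun n => ?_)
      (tendsto_const_div_atTop_nhds_zero_nat ‖A ⟨x, hx⟩‖ |>.comp (tendsto_add_atTop_nat 1))
    rw [norm_sub_rev]
    refine ((hT n).norm_sub_le (hl0 n) hmem).trans (le_of_eq ?_)
    simp [hl]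
  have key : ∀ n x y, (x, y) ∈ A.graph →
      ((I * ((n + 1 : ℕ) : ℝ) / 2 : ℂ) • (J' n - J n)) x = (1 / 2 : ℂ) • (J n y + J' n y) := by
    intro n x y h
    rw [(hJ n).apply_of_mem h, (hJ' n).apply_of_mem h]
    simp only [smul_apply, sub_apply]
    push_cast
    module
  refine ⟨fun n => (I * ((n + 1 : ℕ) : ℝ) / 2 : ℂ) • (J' n - J n), fun n => ?_, fun m n => ?_,
    fun n x y h => ?_, fun x y h => ?_⟩
  · have e := (hJ n).star_eq hA (hn n) (hJ' n)
    rw [IsSelfAdjoint, star_smul, star_sub, e, ← e, star_star, e, ← neg_sub (J' n), smul_neg,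
      ← neg_smul]
    congr 1
    simp only [star_def, map_div₀, map_mul, conj_I, conj_ofReal, map_ofNat]
    ring
  · refine Commute.smul_left (Commute.smul_right ?_ _) _
    refine Commute.sub_left (Commute.sub_right ?_ ?_) (Commute.sub_right ?_ ?_)
    · exact (hJ' m).commute hA (hn' m) (hn' n) (hJ' n)
    · exact (hJ' m).commute hA (hn' m) (hn n) (hJ n)
    · exact (hJ m).commute hA (hn m) (hn' n) (hJ' n)
    · exact (hJ m).commute hA (hn m) (hn n) (hJ n)
  · rw [key n x y h, norm_smul]
    have h1 := norm_add_le (J n y) (J' n y)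
    have h2 := (hJ n).norm_le y
    have h3 := (hJ' n).norm_le y
    simp only [one_div, norm_inv, Complex.norm_ofNat]
    linarith
  · simp only [key _ x y h]
    have h1 := (lim _ J hn (fun n => abs_of_pos (by positivity)) hJ y).add
      (lim _ J' hn' (fun n => by rw [abs_neg]; exact abs_of_pos (by positivity)) hJ' y)
    have h2 := h1.const_smul (1 / 2 : ℂ)
    have e : (1 / 2 : ℂ) • (y + y) = y := by module
    rwa [e] at h2

end Resolvent

section Stone

variable {K : Type*} [NormedAddCommGroup K] [InnerProductSpace ℂ K] [CompleteSpace K]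

theorem norm_apply_of_mem_unitary {u : K →L[ℂ] K} (hu : u ∈ unitary (K →L[ℂ] K)) (x : K) :
    ‖u x‖ = ‖x‖ :=
  ContinuousLinearMap.norm_map_of_mem_unitary hu x

/-- The unitary group `exp(-i t a)` of a bounded operator `a`. -/
def boundedGroup (a : K →L[ℂ] K) (t : ℝ) : K →L[ℂ] K :=
  NormedSpace.exp (t • ((-I) • a))

section BoundedGroup

variable {a b : K →L[ℂ] K}

theorem boundedGroup_zero : boundedGroup a 0 = 1 := by
  simp [boundedGroup]

theorem boundedGroup_add (s t : ℝ) :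
    boundedGroup a (s + t) = boundedGroup a s * boundedGroup a t := by
  unfold boundedGroup
  let +nondep : NormedAlgebra ℚ (K →L[ℂ] K) := .restrictScalars ℚ ℂ _
  rw [add_smul, NormedSpace.exp_add_of_commute]
  exact ((Commute.refl _).smul_left _).smul_right _

theorem boundedGroup_add_of_commute (h : Commute a b) (t : ℝ) :
    boundedGroup (a + b) t = boundedGroup a t * boundedGroup b t := by
  unfold boundedGroup
  let +nondep : NormedAlgebra ℚ (K →L[ℂ] K) := .restrictScalars ℚ ℂ _
  rw [smul_add, smul_add, NormedSpace.exp_add_of_commute]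
  exact ((((h.smul_left _).smul_right _).smul_left _).smul_right _)

theorem boundedGroup_mem_unitary (ha : IsSelfAdjoint a) (t : ℝ) :
    boundedGroup a t ∈ unitary (K →L[ℂ] K) := by
  let +nondep : NormedAlgebra ℚ (K →L[ℂ] K) := .restrictScalars ℚ ℂ _
  refine NormedSpace.exp_mem_unitary_of_mem_skewAdjoint ?_
  rw [skewAdjoint.mem_iff, star_smul, star_smul, ha.star_eq]
  simp

theorem hasDerivAt_boundedGroup (x : K) (t : ℝ) :
    HasDerivAt (fun t => boundedGroup a t x) (boundedGroup a t ((-I) • a x)) t := by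
  have h := hasDerivAt_exp_smul_const (𝕂 := ℝ) ((-I) • a) t
  have h2 := ((ContinuousLinearMap.apply ℂ K x).restrictScalars ℝ).hasFDerivAt.comp_hasDerivAt t h
  exact h2

theorem norm_boundedGroup_apply (ha : IsSelfAdjoint a) (t : ℝ) (x : K) :
    ‖boundedGroup a t x‖ = ‖x‖ :=
  norm_apply_of_mem_unitary (boundedGroup_mem_unitary ha t) x

theorem norm_boundedGroup_sub_add_le (ha : IsSelfAdjoint a) (x y : K) (t C : ℝ)
    (hC : ∀ s, |s| ≤ |t| → ‖a x - y‖ + ‖boundedGroup a s y - y‖ ≤ C) :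
    ‖boundedGroup a t x - x + t • I • y‖ ≤ |t| * C := by
  have h := Convex.norm_image_sub_le_of_norm_hasDerivWithin_le (s := Set.Icc (-|t|) |t|)
    (f := fun s => boundedGroup a s x + s • I • y)
    (f' := fun s => boundedGroup a s ((-I) • a x) + (1 : ℝ) • I • y) (C := C) (x := 0) (y := t)
    (fun s _ => ((hasDerivAt_boundedGroup x s).add
      ((hasDerivAt_id s).smul_const _)).hasDerivWithinAt)
    (fun s hs => by
      have e : boundedGroup a s ((-I) • a x) + (1 : ℝ) • I • y =
          (-I) • (boundedGroup a s (a x - y) + (boundedGroup a s y - y)) := by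
        rw [map_smul, map_sub]
        module
      rw [e, norm_smul, norm_neg, norm_I, one_mul]
      refine (norm_add_le _ _).trans ?_
      rw [norm_boundedGroup_apply ha]
      exact hC s (abs_le.2 hs))
    (convex_Icc _ _) ⟨by simp, by simp⟩ (abs_le.1 le_rfl)
  simp only [boundedGroup_zero, zero_smul, add_zero, sub_zero, Real.norm_eq_abs] at h
  rw [mul_comm]
  refine le_trans (le_of_eq ?_) h
  congr 1
  change _ = _ + _ - x
  abel

theorem norm_boundedGroup_sub_le (ha : IsSelfAdjoint a) (x : K) (t : ℝ) :
    ‖boundedGroup a t x - x‖ ≤ |t| * ‖a x‖ := by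
  simpa using norm_boundedGroup_sub_add_le ha x 0 t ‖a x‖ (by simp)

theorem norm_boundedGroup_sub_boundedGroup_le (ha : IsSelfAdjoint a) (hb : IsSelfAdjoint b)
    (hab : Commute a b) (x : K) (t : ℝ) :
    ‖boundedGroup a t x - boundedGroup b t x‖ ≤ |t| * ‖a x - b x‖ := by
  have e : boundedGroup a t = boundedGroup b t * boundedGroup (a - b) t := by
    rw [← boundedGroup_add_of_commute (hab.symm.sub_right (Commute.refl b)), add_sub_cancel]
  have h := norm_boundedGroup_sub_le (ha.sub hb) x t
  rw [e]
  change ‖boundedGroup b t _ - _‖ ≤ _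
  rwa [← map_sub, norm_boundedGroup_apply hb]

end BoundedGroup

/-- **Stone's theorem**, existence of the unitary group. -/
theorem IsMaximallySymmetric.exists_isExpGroup {A : K →ₗ.[ℂ] K} (hA : IsMaximallySymmetric A) :
    ∃ U : ℝ → K →L[ℂ] K, IsExpGroup A U := by
  obtain ⟨a, hsa, hcomm, hbound, hlim⟩ := hA.exists_approx
  have hgraph : ∀ x : A.domain, ((x : K), A x) ∈ A.graph := fun x => A.mem_graph x
  -- pointwise convergence
  have hcauchy : ∀ (t : ℝ) (x : K), CauchySeq fun n => boundedGroup (a n) t x := by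
    intro t x
    rw [Metric.cauchySeq_iff]
    intro ε hε
    obtain ⟨y, hy, hxy⟩ := hA.dense_domain.exists_dist_lt x (show 0 < ε / 3 by positivity)
    have hc := (hlim y _ (hgraph ⟨y, hy⟩)).cauchySeq
    obtain ⟨N, hN⟩ := Metric.cauchySeq_iff.1 hc (ε / (3 * (|t| + 1))) (by positivity)
    refine ⟨N, fun m hm n hn => ?_⟩
    have h1 : ∀ n, dist (boundedGroup (a n) t x) (boundedGroup (a n) t y) = dist x y := by
      intro n
      rw [dist_eq_norm, dist_eq_norm, ← map_sub, norm_boundedGroup_apply (hsa n)]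
    have h2 := norm_boundedGroup_sub_boundedGroup_le (hsa m) (hsa n) (hcomm m n) y t
    have h3 := hN m hm n hn
    rw [dist_eq_norm] at h3
    have h4 : |t| * ‖a m y - a n y‖ ≤ ε / 3 := by
      calc |t| * ‖a m y - a n y‖ ≤ (|t| + 1) * (ε / (3 * (|t| + 1))) := by
            gcongr
            linarith
        _ = ε / 3 := by field_simp
    have h5 := dist_triangle4 (boundedGroup (a m) t x) (boundedGroup (a m) t y)
      (boundedGroup (a n) t y) (boundedGroup (a n) t x)
    rw [h1, dist_comm (boundedGroup (a n) t y), h1, dist_eq_norm (boundedGroup (a m) t y)] at h5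
    linarith
  choose V hV using fun t x => cauchySeq_tendsto_of_complete (hcauchy t x)
  let U : ℝ → K →L[ℂ] K := fun t =>
    continuousLinearMapOfTendsto (fun n => boundedGroup (a n) t) (tendsto_pi_nhds.2 (hV t))
  have hU : ∀ t x, Tendsto (fun n => boundedGroup (a n) t x) atTop (𝓝 (U t x)) := hV
  have hnorm : ∀ t x, ‖U t x‖ = ‖x‖ := fun t x =>
    tendsto_nhds_unique (hU t x).norm (by simp [norm_boundedGroup_apply (hsa _)])
  have hzero : U 0 = 1 := by
    ext x
    exact tendsto_nhds_unique (hU 0 x) (by simp [boundedGroup_zero])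
  have hadd : ∀ s t, U (s + t) = U s * U t := by
    intro s t
    ext x
    refine tendsto_nhds_unique (hU _ x) ?_
    have h1 : Tendsto (fun n => boundedGroup (a n) s (boundedGroup (a n) t x - U t x)) atTop
        (𝓝 0) := by
      rw [tendsto_zero_iff_norm_tendsto_zero]
      simp only [norm_boundedGroup_apply (hsa _)]
      exact tendsto_iff_norm_sub_tendsto_zero.1 (hU t x)
    have h2 := h1.add (hU s (U t x))
    simp only [map_sub, sub_add_cancel, zero_add] at h2
    simp only [boundedGroup_add]
    exact h2
  have hinv : ∀ t, U t * U (-t) = 1 := fun t => by rw [← hadd, add_neg_cancel, hzero]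
  have hunit : ∀ t, U t ∈ unitary (K →L[ℂ] K) := by
    intro t
    have h1 : star (U t) * U t = 1 := by
      rw [ContinuousLinearMap.star_eq_adjoint]
      exact (ContinuousLinearMap.norm_map_iff_adjoint_comp_self (U t)).1 (hnorm t)
    have h2 : star (U t) = U (-t) := by
      calc star (U t) = star (U t) * (U t * U (-t)) := by rw [hinv, mul_one]
        _ = U (-t) := by rw [← mul_assoc, h1, one_mul]
    exact Unitary.mem_iff.2 ⟨h1, by rw [h2, hinv]⟩
  -- estimates on the domain
  have hest : ∀ x y, (x, y) ∈ A.graph → ∀ z z', (z, z') ∈ A.graph → ∀ t,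
      ‖U t x - x + t • I • y‖ ≤ |t| * (2 * ‖y - z‖ + |t| * ‖z'‖) := by
    intro x y hxy z z' hz t
    have h1 : Tendsto (fun n => ‖boundedGroup (a n) t x - x + t • I • y‖) atTop
        (𝓝 ‖U t x - x + t • I • y‖) := (((hU t x).sub_const x).add_const _).norm
    have h2 : Tendsto (fun n => |t| * (‖a n x - y‖ + (2 * ‖y - z‖ + |t| * ‖z'‖))) atTop
        (𝓝 (|t| * (0 + (2 * ‖y - z‖ + |t| * ‖z'‖)))) :=
      ((tendsto_iff_norm_sub_tendsto_zero.1 (hlim x y hxy)).add_const _).const_mul _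
    rw [zero_add] at h2
    refine le_of_tendsto_of_tendsto' h1 h2 fun n => ?_
    refine norm_boundedGroup_sub_add_le (hsa n) x y t _ fun s hs => ?_
    gcongr
    have e : boundedGroup (a n) s y - y =
        boundedGroup (a n) s (y - z) + (boundedGroup (a n) s z - z) + (z - y) := by
      rw [map_sub]; abel
    rw [e]
    refine (norm_add₃_le).trans ?_
    rw [norm_boundedGroup_apply (hsa n), norm_sub_rev z y]
    have h3 := norm_boundedGroup_sub_le (hsa n) z s
    have h4 : |s| * ‖a n z‖ ≤ |t| * ‖z'‖ := by
      gcongr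
      exact hbound n z z' hz
    linarith
  have hderiv : ∀ x y, (x, y) ∈ A.graph → HasDerivAt (fun t => U t x) (-I • y) 0 := by
    intro x y hxy
    rw [hasDerivAt_iff_isLittleO_nhds_zero, Asymptotics.isLittleO_iff]
    intro c hc
    obtain ⟨z, hz, hyz⟩ := hA.dense_domain.exists_dist_lt y (show 0 < c / 4 by positivity)
    rw [dist_eq_norm] at hyz
    have hz' := hgraph ⟨z, hz⟩
    have hball : Metric.ball (0 : ℝ) (c / (2 * (‖A ⟨z, hz⟩‖ + 1))) ∈ 𝓝 (0 : ℝ) :=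
      Metric.ball_mem_nhds _ (by positivity)
    filter_upwards [hball] with t ht
    rw [mem_ball_zero_iff, Real.norm_eq_abs] at ht
    have h1 := hest x y hxy z _ hz' t
    have h2 : |t| * ‖A ⟨z, hz⟩‖ ≤ c / 2 := by
      calc |t| * ‖A ⟨z, hz⟩‖ ≤ c / (2 * (‖A ⟨z, hz⟩‖ + 1)) * (‖A ⟨z, hz⟩‖ + 1) := by
            gcongr
            linarith
        _ = c / 2 := by field_simp
    have e : U (0 + t) x - U 0 x - t • -I • y = U t x - x + t • I • y := by
      rw [hzero, zero_add, neg_smul, smul_neg, sub_neg_eq_add]; rfl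
    rw [e, Real.norm_eq_abs, mul_comm c]
    refine h1.trans ?_
    gcongr
    linarith
  refine ⟨U, hzero, hadd, hunit, fun x => ?_, fun x y => ⟨hderiv x y, fun h => ?_⟩⟩
  · -- strong continuity
    have h0 : ContinuousAt (fun t => U t x) 0 := by
      rw [Metric.continuousAt_iff]
      intro ε hε
      obtain ⟨z, hz, hxz⟩ := hA.dense_domain.exists_dist_lt x (show 0 < ε / 3 by positivity)
      obtain ⟨δ, hδ, h⟩ := Metric.continuousAt_iff.1
        (hderiv z _ (hgraph ⟨z, hz⟩)).continuousAt (ε / 3) (by positivity)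
      refine ⟨δ, hδ, fun t ht => ?_⟩
      have h1 : ∀ t, dist (U t x) (U t z) = dist x z := fun t => by
        rw [dist_eq_norm, dist_eq_norm, ← map_sub, hnorm]
      have h2 := dist_triangle4 (U t x) (U t z) (U 0 z) (U 0 x)
      rw [h1, dist_comm (U 0 z), h1] at h2
      have := h ht
      linarith
    rw [continuous_iff_continuousAt]
    intro t
    have h1 : ContinuousAt (fun s => U t (U (s - t) x)) t := by
      refine (U t).continuous.continuousAt.comp ?_
      refine ContinuousAt.comp (f := fun s => s - t) (g := fun s => U s x) ?_ (by fun_prop)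
      simpa using h0
    refine h1.congr (Eventually.of_forall fun s => ?_)
    change (U t * U (s - t)) x = _
    rw [← hadd, add_sub_cancel]
  · -- the generator is not a proper extension
    obtain ⟨w, w', hw, hww⟩ := hA.surj 1 one_ne_zero (y + (I * (1 : ℝ)) • x)
    have hv : HasDerivAt (fun t => U t (x - w)) (-(x - w)) 0 := by
      have h1 := h.sub (hderiv w w' hw)
      have e : -I • y - -I • w' = -(x - w) := by
        have e2 : y - w' = I • (w - x) := by
          simp only [ofReal_one, mul_one] at hww
          rw [smul_sub, sub_eq_sub_iff_add_eq_add, ← hww]; abel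
        rw [← smul_sub, e2, smul_smul, neg_mul, I_mul_I]
        simp
      rw [e] at h1
      refine h1.congr_of_eventuallyEq (Eventually.of_forall fun t => ?_)
      simp
    have h2 := (hv.inner ℂ hv)
    have h3 : (fun t => ⟪U t (x - w), U t (x - w)⟫_ℂ) = fun _ => ((‖x - w‖ ^ 2 : ℝ) : ℂ) := by
      ext t
      rw [inner_self_eq_norm_sq_to_K, hnorm]
      norm_num
    rw [h3] at h2
    have h4 := h2.unique (hasDerivAt_const _ _)
    simp only [hzero, inner_neg_left, inner_neg_right] at h4
    change -⟪x - w, x - w⟫_ℂ + -⟪x - w, x - w⟫_ℂ = 0 at h4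
    have h5 : ⟪x - w, x - w⟫_ℂ = 0 := by linear_combination (-1 / 2 : ℂ) * h4
    have h6 : x = w := sub_eq_zero.1 (inner_self_eq_zero.1 h5)
    subst h6
    rw [add_left_injective _ hww] at hw
    exact hw

theorem expNegI_isExpGroup {A : K →ₗ.[ℂ] K} (hA : IsMaximallySymmetric A) :
    IsExpGroup A (expNegI A) := by
  have h := hA.exists_isExpGroup
  have e : expNegI A = h.choose := by
    ext1 s
    rw [expNegI, dif_pos h]
  rw [e]
  exact h.choose_spec

theorem expNegI_mem_unitary (A : K →ₗ.[ℂ] K) (s : ℝ) : expNegI A s ∈ unitary (K →L[ℂ] K) := by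
  unfold expNegI
  split_ifs with h
  · exact h.choose_spec.unitary s
  · exact one_mem _

end Stone

section ClosedSpan

variable {K : Type*} [NormedAddCommGroup K] [InnerProductSpace ℂ K]

/-- The pairs `p` with `⟪p.2, q.1⟫ = ⟪p.1, q.2⟫`. -/
def formalAdjointTo (q : K × K) : Submodule ℂ (K × K) where
  carrier := {p | ⟪p.2, q.1⟫_ℂ = ⟪p.1, q.2⟫_ℂ}
  add_mem' := by
    intro p p' h h'
    simp only [Set.mem_ofPred_eq, Prod.fst_add, Prod.snd_add, inner_add_left] at *
    rw [h, h']
  zero_mem' := by simp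
  smul_mem' := by
    intro c p h
    simp only [Set.mem_ofPred_eq, Prod.smul_fst, Prod.smul_snd, inner_smul_left] at *
    rw [h]

theorem mem_formalAdjointTo {p q : K × K} :
    p ∈ formalAdjointTo q ↔ ⟪p.2, q.1⟫_ℂ = ⟪p.1, q.2⟫_ℂ := Iff.rfl

theorem mem_formalAdjointTo_comm {p q : K × K} :
    p ∈ formalAdjointTo q ↔ q ∈ formalAdjointTo p := by
  rw [mem_formalAdjointTo, mem_formalAdjointTo, ← inner_conj_symm, ← inner_conj_symm p.1]
  constructor
  · intro h; exact (star_injective h).symm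
  · intro h; rw [h]

theorem isClosed_formalAdjointTo (q : K × K) :
    IsClosed (formalAdjointTo q : Set (K × K)) :=
  isClosed_eq (f := fun p : K × K => ⟪p.2, q.1⟫_ℂ) (g := fun p : K × K => ⟪p.1, q.2⟫_ℂ)
    (by fun_prop) (by fun_prop)

theorem closure_span_le_formalAdjointTo {G : Set (K × K)} {q : K × K}
    (h : ∀ p ∈ G, p ∈ formalAdjointTo q) :
    (Submodule.span ℂ G).topologicalClosure ≤ formalAdjointTo q :=
  Submodule.topologicalClosure_minimal _ (Submodule.span_le.2 h) (isClosed_formalAdjointTo q)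

/-- A criterion for the essential self-adjointness of a symmetric operator given by a set of pairs. -/
theorem isMaximallySymmetric_opOfPairs [CompleteSpace K] {G : Set (K × K)}
    (hsymm : ∀ p ∈ G, ∀ q ∈ G, ⟪p.2, q.1⟫_ℂ = ⟪p.1, q.2⟫_ℂ)
    (hdense : ∀ v, (∀ p ∈ G, ⟪p.1, v⟫_ℂ = 0) → v = 0)
    (hrange : ∀ l : ℝ, l ≠ 0 → ∀ v, (∀ p ∈ G, ⟪p.2 + (I * l) • p.1, v⟫_ℂ = 0) → v = 0) :
    IsMaximallySymmetric (opOfPairs G) := by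
  set Γ := (Submodule.span ℂ G).topologicalClosure with hΓ
  have hG : ∀ p ∈ G, p ∈ Γ := fun p hp =>
    Submodule.le_topologicalClosure _ (Submodule.subset_span hp)
  have h1 : ∀ q ∈ G, Γ ≤ formalAdjointTo q := fun q hq =>
    closure_span_le_formalAdjointTo fun p hp => hsymm p hp q hq
  have h2 : ∀ q ∈ Γ, Γ ≤ formalAdjointTo q := fun q hq =>
    closure_span_le_formalAdjointTo fun p hp => mem_formalAdjointTo_comm.1 (h1 p hp hq)
  have hgraph : (opOfPairs G).graph = Γ := by
    refine Submodule.toLinearPMap_graph_eq _ fun p hp hp0 => ?_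
    refine hdense _ fun q hq => ?_
    have := h1 q hq hp
    rw [mem_formalAdjointTo, hp0, inner_zero_left] at this
    rw [← inner_conj_symm, this, map_zero]
  refine ⟨fun x y x' y' h h' => ?_, fun l hl z => ?_⟩
  · rw [hgraph] at h h'
    exact h2 _ h' h
  · let L : Γ →L[ℂ] K := (ContinuousLinearMap.snd ℂ K K +
      (I * l : ℂ) • ContinuousLinearMap.fst ℂ K K).comp Γ.subtypeL
    have hL : ∀ p : Γ, L p = p.1.2 + (I * l : ℂ) • p.1.1 := fun p => rfl
    have : CompleteSpace Γ := (Submodule.isClosed_topologicalClosure _).completeSpace_coe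
    have hbound : ∀ p : Γ, ‖p‖ ≤ (max 1 |l|⁻¹).toNNReal * ‖L p‖ := by
      intro p
      have hs := norm_sq_add_I_smul (h2 _ p.2 p.2) l
      rw [← hL] at hs
      have ha : ‖p.1.2‖ ≤ ‖L p‖ := le_of_sq_le_sq (by nlinarith [sq_nonneg ‖(I * l : ℂ) • p.1.1‖])
        (norm_nonneg _)
      have hb : ‖(I * l : ℂ) • p.1.1‖ ≤ ‖L p‖ :=
        le_of_sq_le_sq (by nlinarith [sq_nonneg ‖p.1.2‖]) (norm_nonneg _)
      have hc : ‖p.1.1‖ ≤ |l|⁻¹ * ‖L p‖ := by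
        rw [norm_smul] at hb
        rw [inv_mul_eq_div, le_div_iff₀ (abs_pos.2 hl), mul_comm]
        simpa using hb
      rw [Real.coe_toNNReal _ (le_max_of_le_left zero_le_one)]
      refine max_le (hc.trans ?_) (ha.trans ?_)
      · gcongr; exact le_max_right _ _
      · exact le_mul_of_one_le_left (norm_nonneg _) (le_max_left _ _)
    have hcl : IsClosed (LinearMap.range (L : Γ →ₗ[ℂ] K) : Set K) :=
      (AddMonoidHomClass.antilipschitz_of_bound L hbound).isClosed_range L.uniformContinuous
    have htop : (LinearMap.range (L : Γ →ₗ[ℂ] K)).topologicalClosure = ⊤ := by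
      rw [Submodule.topologicalClosure_eq_top_iff, Submodule.eq_bot_iff]
      intro v hv
      refine hrange l hl v fun p hp => ?_
      exact (Submodule.mem_orthogonal _ _).1 hv _ ⟨⟨p, hG p hp⟩, rfl⟩
    rw [hcl.submodule_topologicalClosure_eq] at htop
    have hz : z ∈ LinearMap.range (L : Γ →ₗ[ℂ] K) := by rw [htop]; trivial
    obtain ⟨p, hp⟩ := hz
    exact ⟨p.1.1, p.1.2, by rw [hgraph]; exact p.2, hp⟩

end ClosedSpan

section SelfAdjoint

variable {X : Type*} [NormedAddCommGroup X] [InnerProductSpace ℂ X] [CompleteSpace X]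
  {A : X →ₗ.[ℂ] X}

theorem mem_graph_iff_of_isSelfAdjoint (hA : IsSelfAdjoint A) {x' y' : X} :
    (x', y') ∈ A.graph ↔ ∀ x y, (x, y) ∈ A.graph → ⟪y, x'⟫_ℂ = ⟪x, y'⟫_ℂ := by
  have h := LinearPMap.adjoint_graph_eq_graph_adjoint hA.dense_domain
  rw [LinearPMap.isSelfAdjoint_def.1 hA] at h
  conv_lhs => rw [h]
  rw [Submodule.mem_adjoint_iff]
  simp only [sub_eq_zero]

theorem dense_range_add_of_isSelfAdjoint (hA : IsSelfAdjoint A) {l : ℝ} (hl : l ≠ 0) :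
    Dense {z : X | ∃ x y, (x, y) ∈ A.graph ∧ z = y + (I * l) • x} := by
  let L : A.graph →ₗ[ℂ] X :=
    (LinearMap.snd ℂ X X + (I * l : ℂ) • LinearMap.fst ℂ X X).comp A.graph.subtype
  have e : {z : X | ∃ x y, (x, y) ∈ A.graph ∧ z = y + (I * l) • x} = LinearMap.range L := by
    ext z
    constructor
    · rintro ⟨x, y, h, rfl⟩
      exact ⟨⟨(x, y), h⟩, rfl⟩
    · rintro ⟨p, rfl⟩
      exact ⟨p.1.1, p.1.2, p.2, rfl⟩
  rw [e, Submodule.dense_iff_topologicalClosure_eq_top, Submodule.topologicalClosure_eq_top_iff,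
    Submodule.eq_bot_iff]
  intro z hz
  have h1 : (z, (I * l : ℂ) • z) ∈ A.graph := by
    rw [mem_graph_iff_of_isSelfAdjoint hA]
    intro x y h
    have h2 : ⟪y + (I * l : ℂ) • x, z⟫_ℂ = 0 :=
      (Submodule.mem_orthogonal _ _).1 hz _ ⟨⟨(x, y), h⟩, rfl⟩
    rw [inner_add_left, inner_smul_left] at h2
    rw [inner_smul_right]
    simp only [map_mul, conj_I, conj_ofReal] at h2
    linear_combination h2
  have h2 := (mem_graph_iff_of_isSelfAdjoint hA).1 h1 _ _ h1
  rw [inner_smul_left, inner_smul_right] at h2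
  simp only [map_mul, conj_I, conj_ofReal] at h2
  have h3 : (I * l : ℂ) * ⟪z, z⟫_ℂ = 0 := by linear_combination (-1 / 2 : ℂ) * h2
  have h4 : (I * l : ℂ) ≠ 0 := by simp [hl]
  exact inner_self_eq_zero.1 ((mul_eq_zero.1 h3).resolve_left h4)

end SelfAdjoint

section Tensor

variable {X Y : Type*} [NormedAddCommGroup X] [InnerProductSpace ℂ X]
  [NormedAddCommGroup Y] [InnerProductSpace ℂ Y]

theorem inner_htmul (x x' : X) (y y' : Y) :
    ⟪htmul x y, htmul x' y'⟫_ℂ = ⟪x, x'⟫_ℂ * ⟪y, y'⟫_ℂ := by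
  unfold htmul
  rw [UniformSpace.Completion.inner_coe, TensorProduct.inner_tmul]

theorem htmul_add_left (x x' : X) (y : Y) : htmul (x + x') y = htmul x y + htmul x' y := by
  unfold htmul
  rw [TensorProduct.add_tmul, UniformSpace.Completion.coe_add]

theorem htmul_smul_left (c : ℂ) (x : X) (y : Y) : htmul (c • x) y = c • htmul x y := by
  unfold htmul
  rw [← TensorProduct.smul_tmul', UniformSpace.Completion.coe_smul]

theorem continuous_htmul_left (y : Y) : Continuous fun x : X => htmul x y :=
  (UniformSpace.Completion.continuous_coe _).comp
    (TensorProduct.continuous_tmul.comp (Continuous.prodMk continuous_id continuous_const))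

theorem eq_zero_of_inner_htmul {s : Set X} (hs : Dense s) {v : HilbertTensor X Y}
    (h : ∀ x ∈ s, ∀ y, ⟪htmul x y, v⟫_ℂ = 0) : v = 0 := by
  have h1 : ∀ x y, ⟪htmul x y, v⟫_ℂ = 0 := fun x y =>
    congrFun (Continuous.ext_on hs (f := fun x => ⟪htmul x y, v⟫_ℂ) (g := fun _ => 0)
      ((continuous_htmul_left y).inner continuous_const) continuous_const fun x hx => h x hx y) x
  have h2 : ∀ t : X ⊗[ℂ] Y, ⟪(t : HilbertTensor X Y), v⟫_ℂ = 0 := by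
    intro t
    induction t using TensorProduct.induction_on with
    | zero => rw [UniformSpace.Completion.coe_zero, inner_zero_left]
    | tmul x y => exact h1 x y
    | add s t hs ht => rw [UniformSpace.Completion.coe_add, inner_add_left, hs, ht, add_zero]
  have h3 : ∀ w : HilbertTensor X Y, ⟪w, v⟫_ℂ = 0 := fun w =>
    UniformSpace.Completion.induction_on w
      (isClosed_eq (continuous_id.inner continuous_const) continuous_const) h2
  exact inner_self_eq_zero.1 (h3 v)

theorem isMaximallySymmetric_tensorOne [CompleteSpace X] {A : X →ₗ.[ℂ] X} (hA : IsSelfAdjoint A) :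
    IsMaximallySymmetric (tensorOne A Y) := by
  refine isMaximallySymmetric_opOfPairs ?_ ?_ ?_
  · rintro _ ⟨x, x', y, h, rfl⟩ _ ⟨w, w', u, h', rfl⟩
    simp only [inner_htmul]
    rw [(mem_graph_iff_of_isSelfAdjoint hA).1 h' _ _ h]
  · intro v hv
    refine eq_zero_of_inner_htmul hA.dense_domain fun x hx y => ?_
    exact hv (htmul x y, htmul (A ⟨x, hx⟩) y) ⟨x, A ⟨x, hx⟩, y, A.mem_graph ⟨x, hx⟩, rfl⟩
  · intro l hl v hv
    refine eq_zero_of_inner_htmul (dense_range_add_of_isSelfAdjoint hA hl) ?_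
    rintro _ ⟨x, x', h, rfl⟩ y
    rw [htmul_add_left, htmul_smul_left]
    exact hv (htmul x y, htmul x' y) ⟨x, x', y, h, rfl⟩

end Tensor

section FreeEvolution

variable {K : Type*} [NormedAddCommGroup K] [InnerProductSpace ℂ K] [CompleteSpace K]

/-- `θ = J η` solves `θ' = -(i/ħ) B η` weakly on `[0, T]`. -/
def IsWeakPrimitive (ħ T : ℝ) (J B : K →L[ℂ] K) (η : ℝ → K) : Prop :=
  ∀ ζ : K, ∀ t ∈ Set.Icc 0 T, IntervalIntegrable (fun s => ⟪ζ, B (η s)⟫_ℂ) volume 0 t ∧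
    ⟪ζ, J (η t)⟫_ℂ = -(I / ħ) * ∫ s in (0 : ℝ)..t, ⟪ζ, B (η s)⟫_ℂ

namespace IsWeakPrimitive

variable {ħ T : ℝ} {J B : K →L[ℂ] K} {η : ℝ → K}

theorem comp (h : IsWeakPrimitive ħ T J B η) (hJB : Commute J B) :
    IsWeakPrimitive ħ T J B fun t => J (η t) := by
  intro ζ t ht
  have e : ∀ z, B (J z) = J (B z) := fun z => (congrArg (fun L : K →L[ℂ] K => L z) hJB.eq).symm
  have e2 : ∀ z, ⟪ζ, J z⟫_ℂ = ⟪ContinuousLinearMap.adjoint J ζ, z⟫_ℂ := fun z =>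
    (ContinuousLinearMap.adjoint_inner_left J z ζ).symm
  simp only [e, e2 (B _), e2 (J _)]
  exact h _ t ht

/-- A weak primitive is bounded, by the uniform boundedness principle. -/
theorem exists_bound (h : IsWeakPrimitive ħ T J B η) (hT : 0 ≤ T) :
    ∃ C, ∀ t ∈ Set.Icc 0 T, ‖J (η t)‖ ≤ C := by
  have h1 : ∀ ζ : K, ∃ C, ∀ t : Set.Icc 0 T, ‖innerSL ℂ (J (η t)) ζ‖ ≤ C := by
    intro ζ
    have hc : ContinuousOn (fun t => ⟪ζ, J (η t)⟫_ℂ) (Set.Icc 0 T) := by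
      have h2 := (h ζ T ⟨hT, le_rfl⟩).1
      have h3 := intervalIntegral.continuousOn_primitive_interval' h2 Set.left_mem_uIcc
      rw [Set.uIcc_of_le hT] at h3
      exact (h3.const_mul (-(I / ħ) : ℂ)).congr fun t ht => (h ζ t ht).2
    obtain ⟨C, hC⟩ := isCompact_Icc.exists_bound_of_continuousOn hc
    refine ⟨C, fun t => ?_⟩
    rw [innerSL_apply_apply, norm_inner_symm]
    exact hC t t.2
  obtain ⟨C, hC⟩ := banach_steinhaus h1
  refine ⟨C, fun t ht => ?_⟩
  rw [← innerSL_apply_norm (𝕜 := ℂ)]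
  exact hC ⟨t, ht⟩

omit [CompleteSpace K] in
theorem continuousOn (h : IsWeakPrimitive ħ T J B η) {C : ℝ}
    (hC : ∀ t ∈ Set.Icc 0 T, ‖η t‖ ≤ C) : ContinuousOn (fun t => J (η t)) (Set.Icc 0 T) := by
  have key : ∀ s ∈ Set.Icc 0 T, ∀ t ∈ Set.Icc 0 T,
      dist (J (η s)) (J (η t)) ≤ (‖(I / ħ : ℂ)‖ * (‖B‖ * C)) * dist s t := by
    intro s hs t ht
    set v := J (η s) - J (η t) with hv
    have h1 : ⟪v, v⟫_ℂ = -(I / ħ) * ∫ r in t..s, ⟪v, B (η r)⟫_ℂ := by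
      rw [← intervalIntegral.integral_interval_sub_left (h v s hs).1 (h v t ht).1, mul_sub,
        ← (h v s hs).2, ← (h v t ht).2, ← inner_sub_right]
    have h2 : ‖∫ r in t..s, ⟪v, B (η r)⟫_ℂ‖ ≤ (‖v‖ * (‖B‖ * C)) * |s - t| := by
      refine intervalIntegral.norm_integral_le_of_norm_le_const fun r hr => ?_
      have hr' : r ∈ Set.Icc 0 T := by
        have := Set.uIoc_subset_uIcc hr
        exact (Set.uIcc_subset_Icc ht hs) this
      refine (norm_inner_le_norm _ _).trans ?_
      gcongr
      refine (B.le_opNorm _).trans ?_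
      gcongr
      exact hC r hr'
    have h3 : ‖v‖ * ‖v‖ ≤ ‖v‖ * ((‖(I / ħ : ℂ)‖ * (‖B‖ * C)) * |s - t|) := by
      have h4 := congrArg norm h1
      have h5 : ‖⟪v, v⟫_ℂ‖ = ‖v‖ * ‖v‖ := by
        rw [inner_self_eq_norm_sq_to_K]
        simp [sq]
      rw [norm_mul, norm_neg, h5] at h4
      calc ‖v‖ * ‖v‖ = ‖(I / ħ : ℂ)‖ * ‖∫ r in t..s, ⟪v, B (η r)⟫_ℂ‖ := h4
        _ ≤ ‖(I / ħ : ℂ)‖ * ((‖v‖ * (‖B‖ * C)) * |s - t|) := by gcongr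
        _ = _ := by ring
    rw [dist_eq_norm, ← hv, Real.dist_eq]
    rcases eq_or_ne v 0 with h0 | h0
    · rw [h0, norm_zero]
      have := (norm_nonneg _).trans (hC s hs)
      positivity
    · exact le_of_mul_le_mul_left h3 (norm_pos_iff.2 h0)
  exact (LipschitzOnWith.of_dist_le_mul (K := (‖(I / ħ : ℂ)‖ * (‖B‖ * C)).toNNReal)
    fun s hs t ht => (key s hs t ht).trans (by gcongr; exact Real.le_coe_toNNReal _)).continuousOn

/-- A weak primitive of a continuous function vanishes if `⟪J z, B z⟫` is always real. -/
theorem eq_zero (h : IsWeakPrimitive ħ T J B η) (hT : 0 ≤ T)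
    (hη : ContinuousOn η (Set.Icc 0 T)) (hJB : ∀ z, ⟪B z, J z⟫_ℂ = ⟪J z, B z⟫_ℂ) :
    ∀ t ∈ Set.Icc 0 T, J (η t) = 0 := by
  let w : ℝ → K := Set.IccExtend hT fun t => η t
  have hw : Continuous w := (continuousOn_iff_continuous_domRestrict.1 hη).Icc_extend'
  have hwe : ∀ t ∈ Set.Icc 0 T, w t = η t := fun t ht => Set.IccExtend_of_mem hT _ ht
  have hBw : Continuous fun s => B (w s) := B.continuous.comp hw
  let F : ℝ → K := fun t => (-(I / ħ) : ℂ) • ∫ s in (0 : ℝ)..t, B (w s)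
  have hF : ∀ t, HasDerivAt F ((-(I / ħ) : ℂ) • B (w t)) t := fun t =>
    (intervalIntegral.integral_hasDerivAt_right (hBw.intervalIntegrable _ _)
      (hBw.stronglyMeasurableAtFilter _ _) hBw.continuousAt).const_smul _
  have hFJ : ∀ t ∈ Set.Icc 0 T, F t = J (η t) := by
    intro t ht
    refine ext_inner_left ℂ fun ζ => ?_
    have h1 := (innerSL ℂ ζ).intervalIntegral_comp_comm
      (hBw.intervalIntegrable (μ := volume) 0 t)
    simp only [innerSL_apply_apply] at h1
    rw [(h ζ t ht).2, inner_smul_right, ← h1]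
    congr 1
    refine intervalIntegral.integral_congr fun s hs => ?_
    rw [Set.uIcc_of_le ht.1] at hs
    simp only [hwe s ⟨hs.1, hs.2.trans ht.2⟩]
  have hN : ∀ t ∈ Set.Icc 0 T, HasDerivAt (fun t => ⟪F t, F t⟫_ℂ) 0 t := by
    intro t ht
    have h1 := (hF t).inner ℂ (hF t)
    rw [hFJ t ht, hwe t ht, inner_smul_left, inner_smul_right, hJB] at h1
    have e : -(I / ħ) * ⟪J (η t), B (η t)⟫_ℂ +
        (starRingEnd ℂ) (-(I / ħ)) * ⟪J (η t), B (η t)⟫_ℂ = 0 := by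
      simp only [map_neg, map_div₀, conj_I, conj_ofReal]
      ring
    rwa [e] at h1
  intro t ht
  have h1 := constant_of_has_deriv_right_zero (f := fun t => ⟪F t, F t⟫_ℂ)
    (fun s hs => (hN s hs).continuousAt.continuousWithinAt)
    (fun s hs => (hN s ⟨hs.1, hs.2.le⟩).hasDerivWithinAt) t ht
  have h2 : F 0 = 0 := by simp [F]
  rw [h2, inner_zero_left] at h1
  rw [← hFJ t ht]
  exact inner_self_eq_zero.1 h1

end IsWeakPrimitive

/-- Uniqueness for the weak Schrödinger equation without scattering. -/
theorem IsMaximallySymmetric.eq_zero_of_weak_solution {A : K →ₗ.[ℂ] K}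
    (hA : IsMaximallySymmetric A) {ħ T : ℝ} (hT : 0 ≤ T) {χ : ℝ → K}
    (h : ∀ φ : A.domain, ∀ t ∈ Set.Icc 0 T,
      IntervalIntegrable (fun s => ⟪A φ, χ s⟫_ℂ) volume 0 t ∧
      ⟪(φ : K), χ t⟫_ℂ + (I / ħ) * ∫ s in (0 : ℝ)..t, ⟪A φ, χ s⟫_ℂ = 0) :
    ∀ t ∈ Set.Icc 0 T, χ t = 0 := by
  obtain ⟨J, hJ⟩ := hA.exists_isScaledResolvent one_ne_zero
  obtain ⟨J', hJ'⟩ := hA.exists_isScaledResolvent (neg_ne_zero.2 one_ne_zero)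
  let B : K →L[ℂ] K := I • (1 - J)
  have hB : ∀ z, B z = I • (z - J z) := fun z => rfl
  have hmem : ∀ z, (J z, B z) ∈ A.graph := fun z => by
    have h1 := hJ.mem_graph hA one_ne_zero z
    rwa [ofReal_one, mul_one] at h1
  have hJB : Commute J B := ((Commute.one_right J).sub_right (Commute.refl J)).smul_right I
  have hinner : ∀ z w, ⟪J' z, w⟫_ℂ = ⟪z, J w⟫_ℂ := fun z w =>
    hJ'.inner_apply_left hA (neg_ne_zero.2 one_ne_zero) (by rwa [neg_neg]) z w
  have h0 : IsWeakPrimitive ħ T J B χ := by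
    intro ζ t ht
    have hm := hJ'.mem_graph hA (neg_ne_zero.2 one_ne_zero) ζ
    obtain ⟨φ, hφ, hφ'⟩ := LinearPMap.mem_graph_iff A |>.1 hm
    have h1 := h φ t ht
    have e : ∀ z, ⟪A φ, z⟫_ℂ = ⟪ζ, B z⟫_ℂ := by
      intro z
      rw [hφ', hB, inner_smul_left, inner_smul_right, inner_sub_left, inner_sub_right, hinner]
      simp
    simp only [e] at h1
    refine ⟨h1.1, ?_⟩
    have h2 : ⟪ζ, J (χ t)⟫_ℂ = ⟪(φ : K), χ t⟫_ℂ := by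
      rw [hφ, hinner]
    rw [h2]
    linear_combination h1.2
  have h1 := h0.comp hJB
  have h2 := h1.comp hJB
  obtain ⟨C, hC⟩ := h0.exists_bound hT
  have h3 := h2.eq_zero hT (h1.continuousOn hC) fun z => hA.symm _ _ _ _ (hmem z) (hmem z)
  have hinj : ∀ z, J z = 0 → z = 0 := by
    intro z hz
    have h4 := hmem z
    rw [hB, hz, sub_zero] at h4
    exact (smul_eq_zero.1 (A.graph_fst_eq_zero_snd h4 rfl)).resolve_left I_ne_zero
  intro t ht
  exact hinj _ (hinj _ (hinj _ (h3 t ht)))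

namespace IsExpGroup

variable {A : K →ₗ.[ℂ] K} {U : ℝ → K →L[ℂ] K} (hU : IsExpGroup A U)
include hU

theorem star_apply (t : ℝ) : star (U t) = U (-t) := by
  have h1 := (Unitary.mem_iff.1 (hU.unitary t)).1
  calc star (U t) = star (U t) * (U t * U (-t)) := by
        rw [← hU.add, add_neg_cancel, hU.zero, mul_one]
    _ = U (-t) := by rw [← mul_assoc, h1, one_mul]

theorem hasDerivAt_apply {x y : K} (h : (x, y) ∈ A.graph) (t : ℝ) :
    HasDerivAt (fun s => U s x) (U t (-I • y)) t := by
  have h1 := (hU.generator x y).1 h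
  have h2 : HasDerivAt (fun s => U (s - t) x) (-I • y) t :=
    HasDerivAt.comp_sub_const t t (by rwa [sub_self])
  have h3 := ((U t).restrictScalars ℝ).hasFDerivAt.comp_hasDerivAt t h2
  refine h3.congr_of_eventuallyEq (Eventually.of_forall fun s => ?_)
  change _ = (U t * U (s - t)) x
  rw [← hU.add, add_sub_cancel]

theorem inner_apply (t : ℝ) (x z : K) : ⟪x, U t z⟫_ℂ = ⟪U (-t) x, z⟫_ℂ := by
  rw [← hU.star_apply, ContinuousLinearMap.star_eq_adjoint,
    ContinuousLinearMap.adjoint_inner_left]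

theorem hasDerivAt_inner {x y : K} (h : (x, y) ∈ A.graph) (z : K) (t : ℝ) :
    HasDerivAt (fun s => ⟪x, U s z⟫_ℂ) (-I * ⟪y, U t z⟫_ℂ) t := by
  simp only [hU.inner_apply]
  have h1 := (hU.hasDerivAt_apply h (-t)).scomp t (hasDerivAt_neg t)
  have h2 := h1.inner ℂ (hasDerivAt_const t z)
  convert! h2 using 1
  simp [inner_smul_left]

/-- The free evolution solves the weak Schrödinger equation on every interval. -/
theorem integral_inner (ħ : ℝ) {x y : K} (h : (x, y) ∈ A.graph) (z : K) (r t : ℝ) :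
    (I / ħ) * ∫ s in r..t, ⟪y, U (s / ħ) z⟫_ℂ = ⟪x, U (r / ħ) z⟫_ℂ - ⟪x, U (t / ħ) z⟫_ℂ := by
  have hc : Continuous fun s => ⟪y, U (s / ħ) z⟫_ℂ :=
    continuous_const.inner ((hU.continuous z).comp (continuous_id.div_const ħ))
  have hd : ∀ s, HasDerivAt (fun s => ⟪x, U (s / ħ) z⟫_ℂ)
      (-(I / ħ) * ⟪y, U (s / ħ) z⟫_ℂ) s := by
    intro s
    have h1 := (hU.hasDerivAt_inner h z (s / ħ)).scomp s ((hasDerivAt_id s).div_const ħ)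
    convert! h1 using 1
    simp only [real_smul, ofReal_div, ofReal_one]
    ring
  have h2 := intervalIntegral.integral_eq_sub_of_hasDerivAt (fun s _ => hd s)
    ((hc.const_mul (-(I / ħ) : ℂ)).intervalIntegrable r t)
  rw [intervalIntegral.integral_const_mul] at h2
  linear_combination -h2

end IsExpGroup

end FreeEvolution

namespace ScatteringTimes

variable {M : ℕ} (τ : ScatteringTimes M)

theorem mem_before {r t : ℝ} : r ∈ τ.before t ↔ (∃ k, r ∈ τ.τ k) ∧ 0 ≤ r ∧ r < t := by
  simp [before]

theorem before_subset {r t : ℝ} (h : r ≤ t) : τ.before r ⊆ τ.before t := fun s hs => by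
  rw [mem_before] at *
  exact ⟨hs.1, hs.2.1, hs.2.2.trans_le h⟩

theorem card_before_lt {r t : ℝ} (h : r ∈ τ.before t) :
    (τ.before r).card < (τ.before t).card := by
  refine Finset.card_lt_card ⟨τ.before_subset ((τ.mem_before).1 h).2.2.le, fun h' => ?_⟩
  exact lt_irrefl r ((τ.mem_before).1 (h' h)).2.2

/-- Induction along the scattering times. -/
theorem induction_before {p : ℝ → Prop} (h : ∀ t, (∀ r ∈ τ.before t, p r) → p t) (t : ℝ) : p t := by
  induction hn : (τ.before t).card using Nat.strong_induction_on generalizing t with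
  | _ n ih =>
    exact h t fun r hr => ih _ (hn ▸ τ.card_before_lt hr) r rfl

/-- After the last scattering time `r` before `t` the set of past scattering times is constant. -/
theorem before_eq_insert {r t : ℝ} (hr : r ∈ τ.before t) (hmax : ∀ s ∈ τ.before t, s ≤ r)
    {s : ℝ} (hs : r < s) (hst : s ≤ t) : τ.before s = insert r (τ.before r) := by
  ext q
  rw [Finset.mem_insert]
  constructor
  · intro hq
    rcases (hmax q (τ.before_subset hst hq)).eq_or_lt with h | h
    · exact Or.inl h
    · rw [mem_before] at *
      exact Or.inr ⟨hq.1, hq.2.1, h⟩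
  · rintro (rfl | hq)
    · rw [mem_before] at *
      exact ⟨hr.1, hr.2.1, hs⟩
    · exact τ.before_subset hs.le hq

theorem sort_insert_max {s : Finset ℝ} {r : ℝ} (h : ∀ q ∈ s, q < r) :
    (insert r s).sort (· ≤ ·) = s.sort (· ≤ ·) ++ [r] := by
  have hr : r ∉ s := fun hr => lt_irrefl r (h r hr)
  refine List.Perm.eq_of_pairwise' (r := (· ≤ ·)) (Finset.pairwise_sort _ _) ?_ ?_
  · refine List.pairwise_append.2 ⟨Finset.pairwise_sort _ _, List.pairwise_singleton _ _, ?_⟩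
    intro a ha b hb
    rw [List.mem_singleton] at hb
    subst hb
    exact (h a ((Finset.mem_sort _).1 ha)).le
  · refine (Finset.sort_perm_toList _ _).trans ((Finset.toList_insert hr).trans ?_)
    exact ((Finset.sort_perm_toList _ _).symm.cons r).trans (List.perm_append_singleton _ _).symm

variable {K : Type*} [NormedAddCommGroup K] [InnerProductSpace ℂ K] [CompleteSpace K]

section Unitary

variable {U₀ : ℝ → K →L[ℂ] K} {S : Fin M → ℕ → K →L[ℂ] K}
  (hU : ∀ t, U₀ t ∈ unitary (K →L[ℂ] K)) (hS : ∀ k n, S k n ∈ unitary (K →L[ℂ] K))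
include hU hS

theorem interactionScattering_mem_unitary (r : ℝ) :
    τ.interactionScattering U₀ S r ∈ unitary (K →L[ℂ] K) := by
  refine mul_mem (mul_mem (Unitary.star_mem (hU r)) ?_) (hU r)
  unfold scatteringAt
  split_ifs
  · exact hS _ _
  · exact one_mem _

theorem evolution_mem_unitary (t : ℝ) : τ.evolution U₀ S t ∈ unitary (K →L[ℂ] K) := by
  refine mul_mem (hU t) (Unitary.star_mem (list_prod_mem fun u hu => ?_))
  obtain ⟨r, -, rfl⟩ := List.mem_map.1 hu
  exact Unitary.star_mem (τ.interactionScattering_mem_unitary hU hS r)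

end Unitary

/-- Between two scatterings the evolution is the free one. -/
theorem evolution_apply_of_insert (U₀ : ℝ → K →L[ℂ] K) (S : Fin M → ℕ → K →L[ℂ] K) {r s : ℝ}
    (h : τ.before s = insert r (τ.before r)) (ψ₀ : K) :
    τ.evolution U₀ S s ψ₀ =
      U₀ s (star (U₀ r) (τ.scatteringAt S r (τ.evolution U₀ S r ψ₀))) := by
  have e : τ.chronologicalProduct U₀ S s =
      τ.chronologicalProduct U₀ S r * star (τ.interactionScattering U₀ S r) := by
    unfold chronologicalProduct
    rw [h, sort_insert_max fun q hq => ((τ.mem_before).1 hq).2.2]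
    simp
  unfold evolution
  rw [e, star_mul, star_star]
  rfl

theorem evolution_apply_of_before_eq_empty (U₀ : ℝ → K →L[ℂ] K) (S : Fin M → ℕ → K →L[ℂ] K)
    {s : ℝ} (h : τ.before s = ∅) (ψ₀ : K) : τ.evolution U₀ S s ψ₀ = U₀ s ψ₀ := by
  simp [evolution, chronologicalProduct, h]

variable {A : K →ₗ.[ℂ] K} {U : ℝ → K →L[ℂ] K}

theorem isSolution_evolution (hU : IsExpGroup A U) (ħ : ℝ) (S : Fin M → ℕ → K →L[ℂ] K)
    (ψ₀ : K) : τ.IsSolution ħ A S ψ₀ fun t => τ.evolution (fun t => U (t / ħ)) S t ψ₀ := by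
  intro φ t
  have hφ : ((φ : K), A φ) ∈ A.graph := A.mem_graph φ
  have hc : ∀ z, Continuous fun s => ⟪A φ, U (s / ħ) z⟫_ℂ := fun z =>
    continuous_const.inner ((hU.continuous z).comp (continuous_id.div_const ħ))
  induction t using τ.induction_before with
  | _ t ih =>
  intro ht
  rcases (τ.before t).eq_empty_or_nonempty with h0 | hne
  · have e : ∀ s ∈ Set.uIcc 0 t, τ.evolution (fun t => U (t / ħ)) S s ψ₀ = U (s / ħ) ψ₀ := by
      intro s hs
      rw [Set.uIcc_of_le ht] at hs
      refine τ.evolution_apply_of_before_eq_empty _ S ?_ ψ₀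
      exact Finset.subset_empty.1 (h0 ▸ τ.before_subset hs.2)
    have e' : Set.EqOn (fun s => ⟪A φ, U (s / ħ) ψ₀⟫_ℂ)
        (fun s => ⟪A φ, τ.evolution (fun t => U (t / ħ)) S s ψ₀⟫_ℂ) (Set.uIcc 0 t) :=
      fun s hs => by simp only [e s hs]
    refine ⟨((hc ψ₀).intervalIntegrable 0 t).congr (e'.mono Set.uIoc_subset_uIcc), ?_⟩
    have h1 := hU.integral_inner ħ hφ ψ₀ 0 t
    beta_reduce
    rw [← intervalIntegral.integral_congr e', e t Set.right_mem_uIcc, h1, h0, zero_div, hU.zero]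
    simp
  · obtain ⟨r, hr, hmax⟩ : ∃ r ∈ τ.before t, ∀ s ∈ τ.before t, s ≤ r :=
      ⟨_, (τ.before t).max'_mem hne, fun s hs => (τ.before t).le_max' s hs⟩
    obtain ⟨-, hr0, hrt⟩ := (τ.mem_before).1 hr
    obtain ⟨ih1, ih2⟩ := ih r hr hr0
    set Ψ : ℝ → K := fun t => τ.evolution (fun t => U (t / ħ)) S t ψ₀ with hΨ
    set z : K := star (U (r / ħ)) (τ.scatteringAt S r (Ψ r)) with hz
    have e : ∀ s, r < s → s ≤ t → Ψ s = U (s / ħ) z := fun s hs hst =>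
      τ.evolution_apply_of_insert _ S (τ.before_eq_insert hr hmax hs hst) ψ₀
    have hUz : U (r / ħ) z = τ.scatteringAt S r (Ψ r) := by
      change (U (r / ħ) * star (U (r / ħ))) _ = _
      rw [(Unitary.mem_iff.1 (hU.unitary _)).2]
      rfl
    have e' : Set.EqOn (fun s => ⟪A φ, U (s / ħ) z⟫_ℂ) (fun s => ⟪A φ, Ψ s⟫_ℂ)
        (Set.uIoc r t) := fun s hs => by
      rw [Set.uIoc_of_le hrt.le] at hs
      simp only [e s hs.1 hs.2]
    have hint : IntervalIntegrable (fun s => ⟪A φ, Ψ s⟫_ℂ) volume r t :=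
      ((hc z).intervalIntegrable r t).congr e'
    refine ⟨ih1.trans hint, ?_⟩
    have h1 := hU.integral_inner ħ hφ z r t
    rw [intervalIntegral.integral_congr_ae (Eventually.of_forall e'), hUz, ← e t hrt le_rfl] at h1
    rw [← intervalIntegral.integral_add_adjacent_intervals ih1 hint,
      τ.before_eq_insert hr hmax hrt le_rfl,
      Finset.sum_insert fun h => lt_irrefl r ((τ.mem_before).1 h).2.2]
    have h2 : ⟪(φ : K), (τ.scatteringAt S r - 1) (Ψ r)⟫_ℂ =
        ⟪(φ : K), τ.scatteringAt S r (Ψ r)⟫_ℂ - ⟪(φ : K), Ψ r⟫_ℂ := by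
      rw [← inner_sub_right]; rfl
    rw [h2]
    linear_combination ih2 + h1

omit [CompleteSpace K] in
theorem IsSolution.congr {τ : ScatteringTimes M} {ħ : ℝ} {S : Fin M → ℕ → K →L[ℂ] K} {ψ₀ : K}
    {ψ ψ' : ℝ → K} (h : τ.IsSolution ħ A S ψ₀ ψ) (hψ : ∀ t, 0 ≤ t → ψ t = ψ' t) :
    τ.IsSolution ħ A S ψ₀ ψ' := by
  intro φ t ht
  obtain ⟨h1, h2⟩ := h φ t ht
  have e : Set.EqOn (fun s => ⟪A φ, ψ s⟫_ℂ) (fun s => ⟪A φ, ψ' s⟫_ℂ) (Set.uIcc 0 t) := by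
    intro s hs
    rw [Set.uIcc_of_le ht] at hs
    simp only [hψ s hs.1]
  refine ⟨h1.congr (e.mono Set.uIoc_subset_uIcc), ?_⟩
  rw [← intervalIntegral.integral_congr e, ← hψ t ht, h2]
  congr 1
  exact Finset.sum_congr rfl fun r hr => by rw [hψ r ((τ.mem_before).1 hr).2.1]

theorem IsSolution.unique (hA : IsMaximallySymmetric A) {τ : ScatteringTimes M} {ħ : ℝ}
    {S : Fin M → ℕ → K →L[ℂ] K} {ψ₀ : K} {ψ ψ' : ℝ → K} (h : τ.IsSolution ħ A S ψ₀ ψ)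
    (h' : τ.IsSolution ħ A S ψ₀ ψ') (t : ℝ) : 0 ≤ t → ψ t = ψ' t := by
  induction t using τ.induction_before with
  | _ t ih =>
  intro ht
  have key : ∀ φ : A.domain, ∀ s ∈ Set.Icc 0 t,
      IntervalIntegrable (fun s => ⟪A φ, ψ s - ψ' s⟫_ℂ) volume 0 s ∧
      ⟪(φ : K), ψ s - ψ' s⟫_ℂ + (I / ħ) * ∫ q in (0 : ℝ)..s, ⟪A φ, ψ q - ψ' q⟫_ℂ = 0 := by
    intro φ s hs
    obtain ⟨h1, h2⟩ := h φ s hs.1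
    obtain ⟨h1', h2'⟩ := h' φ s hs.1
    have e : ∑ r ∈ τ.before s, ⟪(φ : K), (τ.scatteringAt S r - 1) (ψ r)⟫_ℂ =
        ∑ r ∈ τ.before s, ⟪(φ : K), (τ.scatteringAt S r - 1) (ψ' r)⟫_ℂ :=
      Finset.sum_congr rfl fun r hr => by
        rw [ih r (τ.before_subset hs.2 hr) ((τ.mem_before).1 hr).2.1]
    simp only [inner_sub_right]
    refine ⟨h1.sub h1', ?_⟩
    rw [intervalIntegral.integral_sub h1 h1']
    linear_combination h2 - h2' + e
  exact sub_eq_zero.1 (hA.eq_zero_of_weak_solution ht key t ⟨ht, le_rfl⟩)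

/-- Existence and uniqueness for the scattering equation. -/
theorem isSolution_iff (hA : IsMaximallySymmetric A) (ħ : ℝ) (S : Fin M → ℕ → K →L[ℂ] K)
    (ψ₀ : K) (ψ : ℝ → K) :
    τ.IsSolution ħ A S ψ₀ ψ ↔
      ∀ t : ℝ, 0 ≤ t → ψ t = τ.evolution (fun t => expNegI A (t / ħ)) S t ψ₀ :=
  have hsol := τ.isSolution_evolution (expNegI_isExpGroup hA) ħ S ψ₀
  ⟨fun h => h.unique hA hsol, fun h => hsol.congr fun t ht => (h t ht).symm⟩

end ScatteringTimes

end QScatter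

end

/-- For every initial vector `ψ₀ ∈ 𝓗^{⊗M} ⊗ 𝓔_∞` (symmetric and antisymmetric ones included), the
equation has exactly one solution, `ψ(t, τ_•) = U(t, τ_•) ψ₀` with the unitary operators
`U(t, τ_•) = U₀ᴹ(t) V_t†(τ_•)`, where `U₀ᴹ(t) = exp(-(i/ħ) H₀ᴹ t)` and `H₀ᴹ = Hᴹ ⊗ 1`. -/
theorem proposition3
    {𝓗 : Type*} [NormedAddCommGroup 𝓗] [InnerProductSpace ℂ 𝓗] [CompleteSpace 𝓗]
    (M d : ℕ) (D : QScatter.PointerScale) (ħ κ : ℝ) (hħ : 0 < ħ) (hκ : 0 < κ)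
    (R : Fin d → 𝓗 →ₗ.[ℂ] 𝓗) (hR : ∀ α, IsSelfAdjoint (R α))
    (f₀ : Lp ℂ 2 (D.measure d)) (hf₀ : ‖f₀‖ = 1) (hf₀' : ∀ᵐ y ∂(D.measure d), f₀ y ≠ 0)
    (H : 𝓗 →ₗ.[ℂ] 𝓗) (hH : IsSelfAdjoint H)
    (W : Fin M → Fin M → QScatter.TensorPower 𝓗 M →ₗ.[ℂ] QScatter.TensorPower 𝓗 M)
    (HM : QScatter.TensorPower 𝓗 M →ₗ.[ℂ] QScatter.TensorPower 𝓗 M)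
    (hHM : IsSelfAdjoint HM) (hHW : QScatter.formalHamiltonian H W ≤ HM)
    (τ : QScatter.ScatteringTimes M) :
    let H₀ := QScatter.tensorOne HM (QScatter.BubbleSpace f₀)
    let U₀ : ℝ → _ := fun t => QScatter.expNegI H₀ (t / ħ)
    let S := QScatter.scattering (M := M) ħ κ R f₀
    (∀ t : ℝ, 0 ≤ t → τ.evolution U₀ S t ∈ unitary _) ∧
    ∀ (ψ₀ : QScatter.HilbertTensor (QScatter.TensorPower 𝓗 M) (QScatter.BubbleSpace f₀))
      (ψ : ℝ → QScatter.HilbertTensor (QScatter.TensorPower 𝓗 M) (QScatter.BubbleSpace f₀)),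
      τ.IsSolution ħ H₀ S ψ₀ ψ ↔ ∀ t : ℝ, 0 ≤ t → ψ t = τ.evolution U₀ S t ψ₀ := by
  have h₀ := QScatter.isMaximallySymmetric_tensorOne (Y := QScatter.BubbleSpace f₀) hHM
  refine ⟨fun t _ => ?_, fun ψ₀ ψ => τ.isSolution_iff h₀ ħ _ ψ₀ ψ⟩
  exact τ.evolution_mem_unitary (fun t => QScatter.expNegI_mem_unitary _ _)
    (fun k n => QScatter.expNegI_mem_unitary _ _) t
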